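/- Let $0<q<1$, $l>0$, $\varphi\in\mathbb R$. Write $[t]_q=\frac{q^{t/2}-q^{-t/2}}{q^{1/2}-q^{-1/2}}$ and $(a;q)_\infty=\prod_{r\ge 0}(1-aq^r)$. Let $\mathcal H_l$ be the Hilbert space of the power series $\sum_{n\ge 0} b_n f_n^l(x)$ with $\sum|b_n|^2<\infty$, in which the monomials $f^l_n(x)=c_n^l x^n$, $c_n^l=\prod_{k=1}^n [2l+k-1]_q^{1/2}/[k]_q^{1/2}$, are an orthonormal basis. On power series in $x$ let $$J_0=x\tfrac{d}{dx}+l,\qquad J_\pm=x^{\pm1}[J_0\pm l]_q,\qquad J_\pm=J_1\pm iJ_2,$$ $$I_1^{(\varphi)}=\tfrac a2\,q^{J_0}-b-q^{J_0/4}\,[\cos\varphi\,J_1-\sin\varphi\,J_2]\,q^{J_0/4},\qquad b=(q^{1/2}-q^{-1/2})^{-1},\quad a=(q^{1/4}+q^{-1/4})\,b,$$ and $I_1=I_1^{(0)}$. For $\theta\in\mathbb R$ put $\nu=\cos\theta$, $\lambda=\lambda(\nu;q)=\frac{1-\nu}{q^{-1/2}-q^{1/2}}$ and $$\xi^l_\lambda(x;q)=\frac{(q^{l/2}x;q)_\infty\,(q^{(l+1)/2}x;q)_\infty}{(q^{(1-2l)/4}e^{i\theta}x;q)_\infty\,(q^{(1-2l)/4}e^{-i\theta}x;q)_\infty}.$$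 **Theorem 2.** (i) For every $\theta\in\mathbb R$ the function $$\xi^l_\lambda(e^{i\varphi}x;q)=\frac{(q^{l/2}e^{i\varphi}x;q)_\infty\,(q^{(l+1)/2}e^{i\varphi}x;q)_\infty}{(q^{(1-2l)/4}e^{i(\theta+\varphi)}x;q)_\infty\,(q^{(1-2l)/4}e^{-i(\theta-\varphi)}x;q)_\infty}$$ is a generalized eigenfunction of $I_1^{(\varphi)}$ with eigenvalue $\lambda(\cos\theta;q)$, the same eigenvalue as that of the generalized eigenfunction $\xi^l_\lambda(x;q)$ of $I_1$. That is, in the disc $|x|<q^{(2l-1)/4}$ it is the sum of a nonzero power series that satisfies the eigenvalue equation; this series is, up to a constant factor, the only power series that does so, and it does not belong to $\mathcal H_l$. As $\nu$ runs over $[-1,1]$, these eigenvalues run over $\left[0,\frac{2q^{1/2}}{1-q}\right]$. (ii) $I_1^{(\varphi)}$ and $I_1$ are bounded selfadjoint operators on $\mathcal H_l$. The spectrum of $I_1^{(\varphi)}$ is simple (there is a cyclic vector). Its continuous part (the points of the spectrum that are not eigenvalues with an eigenvector in $\mathcal H_l$) is exactly the interval $\left[0,\frac{2q^{1/2}}{1-q}\right]$;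 in particular the spectrum covers this interval. If $l\ge\frac14$, the whole spectrum is equal to this interval. The spectrum of $I_1^{(\varphi)}$ and its continuous part are the same as those of $I_1$. -/

import Mathlib

open scoped lp

noncomputable section

namespace QSu11

/-- The `q`-number `[a]_q = (q^{a/2} - q^{-a/2}) / (q^{1/2} - q^{-1/2})`. -/
def qNum (q a : ℝ) : ℝ :=
  (q ^ (a / 2) - q ^ (-a / 2)) / (q ^ (1 / 2 : ℝ) - q ^ (-(1 / 2) : ℝ))

/-- The infinite product `(a; q)_∞ = ∏_{r ≥ 0} (1 - a q^r)`. -/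
def qPochInf (a : ℂ) (q : ℝ) : ℂ := ∏' r : ℕ, (1 - a * (q : ℂ) ^ r)

/-! ### The representation operators, acting on power series in `x` -/

/-- The operator `g(J₀(x))`, where `J₀(x) = x d/dx + l`: it multiplies `x^n` by `g (l + n)`. -/
def funJ0 (l : ℝ) (g : ℝ → ℝ) : PowerSeries ℂ →ₗ[ℂ] PowerSeries ℂ where
  toFun f := PowerSeries.mk fun n => (g (l + n) : ℂ) * PowerSeries.coeff n f
  map_add' f h := by ext n; simp [mul_add]
  map_smul' c f := by ext n; simp [mul_left_comm]

/-- Multiplication by `x`. -/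
def mulX : PowerSeries ℂ →ₗ[ℂ] PowerSeries ℂ :=
  LinearMap.mulLeft ℂ (PowerSeries.X : PowerSeries ℂ)

/-- Division by `x` (of a power series without constant term; a constant term is dropped). -/
def divX : PowerSeries ℂ →ₗ[ℂ] PowerSeries ℂ where
  toFun f := PowerSeries.mk fun n => PowerSeries.coeff (n + 1) f
  map_add' f h := by ext n; simp
  map_smul' c f := by ext n; simp

/-- `q^{c J₀}`, that is `f(x) ↦ q^{c l} f(q^c x)`. -/
def qPowJ0 (q l c : ℝ) : PowerSeries ℂ →ₗ[ℂ] PowerSeries ℂ :=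
  funJ0 l fun t => q ^ (c * t)

/-- `J₊(x) = x [J₀(x) + l]_q`. -/
def Jplus (q l : ℝ) : PowerSeries ℂ →ₗ[ℂ] PowerSeries ℂ :=
  mulX ∘ₗ funJ0 l fun t => qNum q (t + l)

/-- `J₋(x) = x⁻¹ [J₀(x) - l]_q`; note that `[J₀(x) - l]_q` kills the constants. -/
def Jminus (q l : ℝ) : PowerSeries ℂ →ₗ[ℂ] PowerSeries ℂ :=
  divX ∘ₗ funJ0 l fun t => qNum q (t - l)

/-- `J₁`, determined together with `J₂` by `J_± = J₁ ± i J₂`. -/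
def J1 (q l : ℝ) : PowerSeries ℂ →ₗ[ℂ] PowerSeries ℂ :=
  (1 / 2 : ℂ) • (Jplus q l + Jminus q l)

/-- `J₂`, determined together with `J₁` by `J_± = J₁ ± i J₂`. -/
def J2 (q l : ℝ) : PowerSeries ℂ →ₗ[ℂ] PowerSeries ℂ :=
  (1 / (2 * Complex.I)) • (Jplus q l - Jminus q l)

/-- The constant `b = (q^{1/2} - q^{-1/2})⁻¹`. -/
def bConst (q : ℝ) : ℝ := (q ^ (1 / 2 : ℝ) - q ^ (-(1 / 2) : ℝ))⁻¹

/-- The constant `a = (q^{1/4} + q^{-1/4}) b`. -/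
def aConst (q : ℝ) : ℝ := (q ^ (1 / 4 : ℝ) + q ^ (-(1 / 4) : ℝ)) * bConst q

/-- `I₁(x) = (a/2) q^{J₀} - b - q^{J₀/4} J₁ q^{J₀/4}`. -/
def I1 (q l : ℝ) : PowerSeries ℂ →ₗ[ℂ] PowerSeries ℂ :=
  ((aConst q / 2 : ℝ) : ℂ) • qPowJ0 q l 1 - (bConst q : ℂ) • LinearMap.id
    - qPowJ0 q l (1 / 4) ∘ₗ J1 q l ∘ₗ qPowJ0 q l (1 / 4)

/-- `I₁^{(φ)}(x) = (a/2) q^{J₀} - b - q^{J₀/4} (cos φ J₁ - sin φ J₂) q^{J₀/4}`. -/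
def I1rot (q l φ : ℝ) : PowerSeries ℂ →ₗ[ℂ] PowerSeries ℂ :=
  ((aConst q / 2 : ℝ) : ℂ) • qPowJ0 q l 1 - (bConst q : ℂ) • LinearMap.id
    - qPowJ0 q l (1 / 4) ∘ₗ ((Real.cos φ : ℂ) • J1 q l - (Real.sin φ : ℂ) • J2 q l)
        ∘ₗ qPowJ0 q l (1 / 4)

/-! ### The Hilbert space `H_l` -/

/-- `c_n^l(q) = ∏_{k=1}^n [2l+k-1]_q^{1/2} / [k]_q^{1/2}`. -/
def cCoeff (q l : ℝ) (n : ℕ) : ℝ :=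
  ∏ k ∈ Finset.Icc 1 n, √(qNum q (2 * l + k - 1)) / √(qNum q k)

/-- The Hilbert space `H_l`, in which the monomials `f_n^l = c_n^l(q) x^n` are an orthonormal basis:
an element is the square-summable sequence `(b_n)` of its coordinates in that basis. -/
abbrev H : Type := ℓ^2(ℕ, ℂ)

/-- The power series `∑ b_n f_n^l = ∑ b_n c_n^l(q) x^n` which the element `(b_n)` of `H_l` is. -/
def toSeries (q l : ℝ) (u : H) : PowerSeries ℂ :=
  PowerSeries.mk fun n => u n * (cCoeff q l n : ℂ)

/-- The bounded operator `T` on `H_l` is given by the operator `A` on power series. -/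
def Realizes (q l : ℝ) (T : H →L[ℂ] H) (A : PowerSeries ℂ →ₗ[ℂ] PowerSeries ℂ) : Prop :=
  ∀ u : H, toSeries q l (T u) = A (toSeries q l u)

/-! ### Eigenfunctions and spectra -/

/-- The function `ξ_λ^l(x; q)`, where `λ = λ(cos θ; q)`. -/
def xi (q l θ : ℝ) (x : ℂ) : ℂ :=
  qPochInf ((q ^ (l / 2) : ℝ) * x) q * qPochInf ((q ^ ((l + 1) / 2) : ℝ) * x) q /
    (qPochInf ((q ^ ((1 - 2 * l) / 4) : ℝ) * Complex.exp (Complex.I * θ) * x) q *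
      qPochInf ((q ^ ((1 - 2 * l) / 4) : ℝ) * Complex.exp (-(Complex.I * θ)) * x) q)

/-- The eigenvalue `λ(ν; q) = (1 - ν) / (q^{-1/2} - q^{1/2})`. -/
def eigval (q ν : ℝ) : ℝ := (1 - ν) / (q ^ (-(1 / 2) : ℝ) - q ^ (1 / 2 : ℝ))

/-- In the disc `|x| < R`, the function `f` is the sum of the power series `F`. -/
def HasExpansion (f : ℂ → ℂ) (F : PowerSeries ℂ) (R : ℝ) : Prop :=
  ∀ x : ℂ, ‖x‖ < R → HasSum (fun n : ℕ => PowerSeries.coeff n F * x ^ n) (f x)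

/-- The function `f` is, up to constant factors, the one and only eigenfunction of `A` with
eigenvalue `μ`: in the disc `|x| < q^{(2l-1)/4}`, where the elements of `H_l` are analytic, it is
the sum of a nonzero power series which spans the solutions of `A G = μ G`. It is a generalized
eigenfunction: it does not belong to `H_l`. -/
def IsGeneralizedEigenfunction (q l : ℝ) (A : PowerSeries ℂ →ₗ[ℂ] PowerSeries ℂ) (μ : ℂ)
    (f : ℂ → ℂ) : Prop :=
  ∃ F : PowerSeries ℂ, F ≠ 0 ∧ HasExpansion f F (q ^ ((2 * l - 1) / 4)) ∧
    A F = μ • F ∧ (∀ G : PowerSeries ℂ, A G = μ • G → ∃ c : ℂ, G = c • F) ∧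
    ∀ u : H, toSeries q l u ≠ F

/-- A bounded selfadjoint operator has simple spectrum if it has a cyclic vector. -/
def HasSimpleSpectrum (T : H →L[ℂ] H) : Prop :=
  ∃ v : H, (Submodule.span ℂ (Set.range fun n : ℕ => (T ^ n) v)).topologicalClosure = ⊤

/-- The continuous spectrum of a bounded selfadjoint operator: the points of the spectrum that
are not eigenvalues with an eigenvector in the Hilbert space. -/
def continuousSpectrum (T : H →L[ℂ] H) : Set ℂ :=
  {z | z ∈ spectrum ℂ T ∧ ¬ Module.End.HasEigenvalue (T : H →ₗ[ℂ] H) z}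

end QSu11

end

open scoped ComplexConjugate
open Filter Topology

noncomputable section

namespace QSu11

/-! ### Diagonal operators and shifts on `ℓ²(ℕ)` -/

/-! In the basis `f_n^l` the operator `I₁` becomes `β (1 - X)`, where `β = q^{1/2}/(1-q)` and `X` is
the Jacobi matrix with diagonal `σ qⁿ` and off-diagonal `½ √((1 - q^{n+1})(1 - p qⁿ))`. Here `p =
q^{2l}`, and `2σ` and `p` are the sum and the product of the Al-Salam–Chihara parameters `q^{l+1/4}`
and `q^{l-1/4}`. The interval of the theorem is the image of `[-1, 1]` under `w ↦ β (1 - w)`.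

Outside `[-1, 1]`: `X` differs by a compact operator from the free Jacobi matrix, whose spectrum
lies in `[-1, 1]`, so every further spectral point is an eigenvalue
(`hasEigenvalue_of_compact_perturbation`). If `l ≥ 1/4`, a weighted AM-GM estimate of the quadratic
form excludes such eigenvalues (`norm_le_one_of_ascOp_eq_smul`).

On `[-1, 1]`: the recurrence of `X` is an `O(qⁿ)` perturbation of `u_{n+2} - (z + z⁻¹) u_{n+1} + u_n
= 0` with `|z| = 1`, and no nonzero solution tends to zero
(`eq_zero_of_tendsto_zero_of_recurrence`). This excludes eigenvectors, shows that `x - X` is not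
surjective, and keeps `ξ` out of `H_l`.

The product formula for `ξ` gives a first-order `q`-difference equation. Its Taylor coefficients
satisfy exactly the three-term recurrence of `I₁`, which determines a series from its constant term.

Finally `f(x) ↦ f(e^{iφ} x)` is unitary and carries `I₁` to `I₁^{(φ)}` (`I1rot_rescale`), which
transfers every statement. The spectrum is simple because the first basis vector is cyclic for a
tridiagonal matrix with nonzero subdiagonal. -/

theorem summable_norm_sq (u : H) : Summable fun n => ‖u n‖ ^ 2 := by
  have := (lp.memℓp u).summable (by norm_num)
  simpa using this

theorem norm_sq_eq_tsum (u : H) : ‖u‖ ^ 2 = ∑' n, ‖u n‖ ^ 2 := by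
  have := lp.norm_rpow_eq_tsum (p := 2) (by norm_num) u
  simpa using this

theorem memℓp_of_summable_sq {u : ℕ → ℂ} (h : Summable fun n => ‖u n‖ ^ 2) : Memℓp u 2 := by
  refine memℓp_gen ?_
  simpa using h

/-- Decay of the coordinates is all that is used of square-summability when eigenvectors at points
of `[-1, 1]` are excluded. -/
theorem tendsto_coord_zero (u : H) : Tendsto (fun n => u n) atTop (𝓝 0) := by
  have h := (summable_norm_sq u).tendsto_atTop_zero
  rw [tendsto_zero_iff_norm_tendsto_zero]
  have := h.sqrt
  simpa using this

theorem norm_le_of_coord_le {u v : H} {C : ℝ} (hC : 0 ≤ C) (h : ∀ n, ‖v n‖ ≤ C * ‖u n‖) :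
    ‖v‖ ≤ C * ‖u‖ := by
  refine le_of_sq_le_sq ?_ (by positivity)
  rw [mul_pow, norm_sq_eq_tsum, norm_sq_eq_tsum, ← tsum_mul_left]
  refine (summable_norm_sq v).tsum_le_tsum (fun n => ?_) ((summable_norm_sq u).mul_left _)
  rw [← mul_pow]
  exact pow_le_pow_left₀ (norm_nonneg _) (h n) 2

/-- The operator multiplying the `n`-th coordinate by `d n`, for a bounded sequence `d`. -/
def diagOp (d : ℕ → ℂ) {C : ℝ} (hd : ∀ n, ‖d n‖ ≤ C) : H →L[ℂ] H :=
  LinearMap.mkContinuous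
    { toFun := fun u => ⟨fun n => d n * u n, memℓp_of_summable_sq <| by
        refine Summable.of_nonneg_of_le (fun _ => by positivity) (fun n => ?_)
          ((summable_norm_sq u).mul_left (C ^ 2))
        rw [norm_mul, mul_pow]
        gcongr
        exact hd n⟩
      map_add' := fun u v => by ext n; exact mul_add _ _ _
      map_smul' := fun c u => by ext n; simp [mul_left_comm] }
    C fun u => norm_le_of_coord_le ((norm_nonneg _).trans (hd 0)) fun n => by
      simpa using mul_le_mul_of_nonneg_right (hd n) (norm_nonneg (u n))

@[simp] theorem diagOp_apply (d : ℕ → ℂ) {C : ℝ} (hd : ∀ n, ‖d n‖ ≤ C) (u : H) (n : ℕ) :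
    diagOp d hd u n = d n * u n := rfl

/-- The backward shift. -/
def shiftL : H →L[ℂ] H :=
  LinearMap.mkContinuous
    { toFun := fun u => ⟨fun n => u (n + 1), memℓp_of_summable_sq <|
        (summable_nat_add_iff (f := fun n => ‖u n‖ ^ 2) 1).2 (summable_norm_sq u)⟩
      map_add' := fun u v => by ext n; rfl
      map_smul' := fun c u => by ext n; simp }
    1 fun u => by
      rw [one_mul]
      refine le_of_sq_le_sq ?_ (by positivity)
      rw [norm_sq_eq_tsum, norm_sq_eq_tsum, (summable_norm_sq u).tsum_eq_zero_add]
      exact le_add_of_nonneg_left (by positivity)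

@[simp] theorem shiftL_apply (u : H) (n : ℕ) : shiftL u n = u (n + 1) := rfl

/-- The forward shift. -/
def shiftR : H →L[ℂ] H := ContinuousLinearMap.adjoint shiftL

theorem coord_eq_inner (u : H) (n : ℕ) : u n = inner ℂ (lp.single 2 n (1 : ℂ)) u := by
  rw [lp.inner_single_left]; simp

@[simp] theorem shiftR_apply_zero (u : H) : shiftR u 0 = 0 := by
  rw [coord_eq_inner, shiftR, ContinuousLinearMap.adjoint_inner_right]
  have : shiftL (lp.single 2 0 (1 : ℂ)) = 0 := by
    ext n; simp [lp.single_apply]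
  simp [this]

@[simp] theorem shiftR_apply_succ (u : H) (n : ℕ) : shiftR u (n + 1) = u n := by
  rw [coord_eq_inner, shiftR, ContinuousLinearMap.adjoint_inner_right]
  have : shiftL (lp.single 2 (n + 1) (1 : ℂ)) = lp.single 2 n (1 : ℂ) := by
    ext m; simp [lp.single_apply, Pi.single_apply]
  rw [this, ← coord_eq_inner]

theorem norm_shiftL_le : ‖shiftL‖ ≤ 1 := LinearMap.mkContinuous_norm_le _ zero_le_one _

theorem norm_shiftR_le : ‖shiftR‖ ≤ 1 := by
  rw [shiftR, LinearIsometryEquiv.norm_map]; exact norm_shiftL_le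

theorem star_diagOp (d : ℕ → ℂ) {C : ℝ} (hd : ∀ n, ‖d n‖ ≤ C) :
    star (diagOp d hd) = diagOp (fun n => conj (d n)) (C := C) (by simpa using hd) := by
  rw [ContinuousLinearMap.star_eq_adjoint, eq_comm, ContinuousLinearMap.eq_adjoint_iff]
  intro u v
  rw [lp.inner_eq_tsum, lp.inner_eq_tsum]
  refine tsum_congr fun n => ?_
  simp
  ring

theorem isSelfAdjoint_diagOp (d : ℕ → ℝ) {C : ℝ} (hd : ∀ n, ‖(d n : ℂ)‖ ≤ C) :
    IsSelfAdjoint (diagOp (fun n => (d n : ℂ)) hd) := by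
  rw [IsSelfAdjoint, star_diagOp]
  ext u n
  simp

theorem star_shiftL : star shiftL = shiftR := rfl

theorem star_shiftR : star shiftR = shiftL := by rw [← star_shiftL, star_star]

/-- The finite-rank truncations `P N` converge in norm, since the remaining entries are uniformly
small. -/
theorem isCompactOperator_diagOp (d : ℕ → ℂ) {C : ℝ} (hd : ∀ n, ‖d n‖ ≤ C)
    (h0 : Tendsto d atTop (𝓝 0)) : IsCompactOperator (diagOp d hd) := by
  let P : ℕ → H →L[ℂ] H := fun N => ∑ k ∈ Finset.range N,
    d k • (lp.singleContinuousLinearMap ℂ (fun _ : ℕ => ℂ) 2 k ∘L lp.evalCLM ℂ (fun _ : ℕ => ℂ) 2 k)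
  have hev : ∀ (k : ℕ) (u : H), lp.evalCLM ℂ (fun _ : ℕ => ℂ) 2 k u = u k := fun _ _ => rfl
  have hP : ∀ N u n, P N u n = if n < N then d n * u n else 0 := by
    intro N u n
    simp only [P, sum_apply, lp.coeFn_sum, Finset.sum_apply]
    simp [lp.single_apply, Pi.single_apply, hev]
  have hc : ∀ N, IsCompactOperator (P N) := by
    intro N
    show P N ∈ compactOperator (RingHom.id ℂ) H H
    refine Submodule.sum_mem _ fun k _ => Submodule.smul_mem _ _ ?_
    have : IsCompactOperator (lp.evalCLM ℂ (fun _ : ℕ => ℂ) 2 k) :=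
      isCompactOperator_of_locallyCompactSpace_dom _
    exact this.clm_comp (lp.singleContinuousLinearMap ℂ (fun _ : ℕ => ℂ) 2 k)
  refine isCompactOperator_of_tendsto (l := atTop) (F := P) ?_ (Eventually.of_forall hc)
  rw [Metric.tendsto_atTop]
  intro ε hε
  obtain ⟨N, hN⟩ := Metric.tendsto_atTop.1 h0 (ε / 2) (by positivity)
  refine ⟨N, fun m hm => ?_⟩
  rw [dist_eq_norm]
  refine lt_of_le_of_lt (ContinuousLinearMap.opNorm_le_bound _ (half_pos hε).le fun u => ?_)
    (half_lt_self hε)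
  refine norm_le_of_coord_le (half_pos hε).le fun n => ?_
  rw [sub_apply, lp.coeFn_sub, Pi.sub_apply, hP, diagOp_apply]
  split_ifs with h
  · simp; positivity
  · have := hN n (by omega)
    rw [dist_zero_right] at this
    rw [zero_sub, norm_neg, norm_mul]
    gcongr

/-! ### Jacobi operators -/

/-- The Jacobi operator with diagonal `α` and off-diagonal `a`. -/
def jacobiOp (α a : ℕ → ℝ) {C C' : ℝ} (hα : ∀ n, ‖(α n : ℂ)‖ ≤ C) (ha : ∀ n, ‖(a n : ℂ)‖ ≤ C') :
    H →L[ℂ] H :=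
  diagOp (fun n => (α n : ℂ)) hα + diagOp (fun n => (a n : ℂ)) ha * shiftL
    + shiftR * diagOp (fun n => (a n : ℂ)) ha

section jacobi
variable (α a : ℕ → ℝ) {C C' : ℝ} (hα : ∀ n, ‖(α n : ℂ)‖ ≤ C) (ha : ∀ n, ‖(a n : ℂ)‖ ≤ C')

theorem jacobiOp_apply_zero (u : H) :
    jacobiOp α a hα ha u 0 = α 0 * u 0 + a 0 * u 1 := by
  simp [jacobiOp]

theorem jacobiOp_apply_succ (u : H) (n : ℕ) :
    jacobiOp α a hα ha u (n + 1) = α (n + 1) * u (n + 1) + a (n + 1) * u (n + 2) + a n * u n := by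
  simp [jacobiOp]

theorem isSelfAdjoint_jacobiOp : IsSelfAdjoint (jacobiOp α a hα ha) := by
  rw [IsSelfAdjoint, jacobiOp, star_add, star_add, star_mul, star_mul, star_shiftL, star_shiftR,
    isSelfAdjoint_diagOp, isSelfAdjoint_diagOp]
  abel

/-- The free Jacobi operator. -/
def freeJacobi : H →L[ℂ] H := (1 / 2 : ℂ) • (shiftL + shiftR)

theorem freeJacobi_apply (u : H) (n : ℕ) :
    freeJacobi u n = (1 / 2 : ℂ) * (u (n + 1) + shiftR u n) := rfl

theorem isSelfAdjoint_freeJacobi : IsSelfAdjoint freeJacobi := by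
  rw [IsSelfAdjoint, freeJacobi, star_smul, star_add, star_shiftL, star_shiftR, add_comm]
  simp

theorem norm_freeJacobi_le : ‖freeJacobi‖ ≤ 1 := by
  rw [freeJacobi, norm_smul]
  have := norm_add_le shiftL shiftR
  have h1 := norm_shiftL_le
  have h2 := norm_shiftR_le
  norm_num
  linarith

instance : Nontrivial H := by
  refine ⟨⟨lp.single 2 0 (1 : ℂ), 0, fun h => ?_⟩⟩
  have := congrArg (fun u : H => u 0) h
  simp at this

/-- Only this inclusion is needed: that `[-1, 1]` belongs to the spectrum is shown directly for the
perturbed operator. -/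
theorem spectrum_freeJacobi {z : ℂ} (hz : z ∈ spectrum ℂ freeJacobi) :
    ∃ x : ℝ, x ∈ Set.Icc (-1) 1 ∧ z = x := by
  have h1 := isSelfAdjoint_freeJacobi.mem_spectrum_eq_re hz
  have h2 := (spectrum.norm_le_norm_of_mem hz).trans norm_freeJacobi_le
  refine ⟨z.re, ?_, h1⟩
  rw [Set.mem_Icc, ← abs_le]
  exact (Complex.abs_re_le_norm z).trans h2

theorem isCompactOperator_jacobiOp_sub_freeJacobi (hα0 : Tendsto α atTop (𝓝 0))
    (ha0 : Tendsto a atTop (𝓝 (1 / 2))) :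
    IsCompactOperator (jacobiOp α a hα ha - freeJacobi) := by
  have hb : ∀ n, ‖((a n : ℂ) - 1 / 2)‖ ≤ C' + 1 / 2 := fun n =>
    (norm_sub_le _ _).trans (by gcongr; exacts [ha n, by norm_num])
  have e : jacobiOp α a hα ha - freeJacobi = diagOp (fun n => (α n : ℂ)) hα
      + diagOp (fun n => (a n : ℂ) - 1 / 2) hb ∘L shiftL
      + shiftR ∘L diagOp (fun n => (a n : ℂ) - 1 / 2) hb := by
    ext u n
    rcases n with _ | n
    · rw [sub_apply, lp.coeFn_sub, Pi.sub_apply, jacobiOp_apply_zero]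
      simp [freeJacobi_apply]
      ring
    · rw [sub_apply, lp.coeFn_sub, Pi.sub_apply, jacobiOp_apply_succ]
      simp [freeJacobi_apply]
      ring
  have hc := isCompactOperator_diagOp (fun n => (a n : ℂ) - 1 / 2) hb (by
    have := (Complex.continuous_ofReal.tendsto _).comp ha0
    have := this.sub_const (1 / 2)
    simpa [Function.comp_def] using this)
  have hd := isCompactOperator_diagOp (fun n => (α n : ℂ)) hα (by
    simpa [Function.comp_def] using (Complex.continuous_ofReal.tendsto _).comp hα0)
  rw [e]
  exact (hd.add (hc.comp_clm shiftL)).add (hc.clm_comp shiftR)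

/-- Weyl's theorem for a compact perturbation: a spectral point outside the spectrum of the
unperturbed operator is an eigenvalue. -/
theorem hasEigenvalue_of_compact_perturbation {S S₀ : H →L[ℂ] H} (hK : IsCompactOperator (S - S₀))
    {z : ℂ} (hz : z ∈ spectrum ℂ S) (hz0 : z ∉ spectrum ℂ S₀) :
    Module.End.HasEigenvalue (S : H →ₗ[ℂ] H) z := by
  rw [spectrum.notMem_iff] at hz0
  obtain ⟨R, hR⟩ := hz0
  have hKR : IsCompactOperator ((↑R⁻¹ : H →L[ℂ] H) ∘L (S - S₀)) := hK.clm_comp _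
  -- With `R = z - S₀` invertible, `z - S = R (1 - R⁻¹(S - S₀))`. The Fredholm alternative for the
  -- compact `R⁻¹(S - S₀)` at `1` yields either a kernel vector of `z - S` or its invertibility.
  have key : algebraMap ℂ (H →L[ℂ] H) z - S
      = R * (algebraMap ℂ (H →L[ℂ] H) 1 - (↑R⁻¹ : H →L[ℂ] H) ∘L (S - S₀)) := by
    change _ = (R : H →L[ℂ] H) * (algebraMap ℂ (H →L[ℂ] H) 1 - (↑R⁻¹ : H →L[ℂ] H) * (S - S₀))
    rw [mul_sub, ← mul_assoc, Units.mul_inv, one_mul, map_one, mul_one, hR]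
    abel
  rcases hKR.hasEigenvalue_or_mem_resolventSet one_ne_zero with h | h
  · obtain ⟨u, hu⟩ := h.exists_hasEigenvector
    have h1 : (↑R⁻¹ : H →L[ℂ] H) ((S - S₀) u) = u := by simpa using hu.apply_eq_smul
    have h2 : (algebraMap ℂ (H →L[ℂ] H) z - S) u = 0 := by
      rw [key]
      simp only [mul_apply_eq_comp, sub_apply, map_one,
        one_apply_eq_self, ContinuousLinearMap.comp_apply]
      simp only [sub_apply] at h1
      rw [h1]; simp
    refine Module.End.hasEigenvalue_of_hasEigenvector (x := u) ⟨?_, hu.2⟩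
    rw [Module.End.mem_eigenspace_iff]
    rw [sub_apply, Algebra.algebraMap_eq_smul_one, sub_eq_zero] at h2
    simpa using h2.symm
  · exact absurd hz (by
      rw [spectrum.notMem_iff, key]
      exact R.isUnit.mul h)

theorem exists_eigenvector_of_mem_spectrum_jacobiOp (hα0 : Tendsto α atTop (𝓝 0))
    (ha0 : Tendsto a atTop (𝓝 (1 / 2))) {z : ℂ} (hz : z ∈ spectrum ℂ (jacobiOp α a hα ha))
    (hz0 : ¬ ∃ x : ℝ, x ∈ Set.Icc (-1) 1 ∧ z = x) :
    Module.End.HasEigenvalue (jacobiOp α a hα ha : H →ₗ[ℂ] H) z :=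
  hasEigenvalue_of_compact_perturbation
    (isCompactOperator_jacobiOp_sub_freeJacobi α a hα ha hα0 ha0) hz
    fun h => hz0 (spectrum_freeJacobi h)

end jacobi

/-! ### Decaying solutions of perturbed three-term recurrences -/

/-- Summing the errors from infinity: `‖w n‖ - D/(1-r) rⁿ` is increasing from `N` on and tends to
`0`, hence is nonpositive. -/
theorem norm_le_of_le_succ_add_geometric {w : ℕ → ℂ} (hw : Tendsto w atTop (𝓝 0)) {D r : ℝ}
    (hr0 : 0 ≤ r) (hr1 : r < 1) {N : ℕ} (h : ∀ n ≥ N, ‖w n‖ ≤ ‖w (n + 1)‖ + D * r ^ n) :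
    ∀ n ≥ N, ‖w n‖ ≤ D / (1 - r) * r ^ n := by
  intro n hn
  have h1r : (1 - r) ≠ 0 := by linarith
  have hmono : Monotone fun k => ‖w (k + n)‖ - D / (1 - r) * r ^ (k + n) := by
    refine monotone_nat_of_le_succ fun k => ?_
    have h1 := h (k + n) (by omega)
    have h2 : D / (1 - r) * r ^ (k + n) - D / (1 - r) * r ^ (k + 1 + n) = D * r ^ (k + n) := by
      field_simp
      ring
    have h3 : k + n + 1 = k + 1 + n := by ring
    rw [h3] at h1
    linarith
  have hlim : Tendsto (fun k => ‖w (k + n)‖ - D / (1 - r) * r ^ (k + n)) atTop (𝓝 0) := by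
    have h1 := (tendsto_add_atTop_iff_nat n).2 hw.norm
    have h2 := (tendsto_add_atTop_iff_nat n).2
      ((tendsto_pow_atTop_nhds_zero_of_lt_one hr0 hr1).const_mul (D / (1 - r)))
    simpa using h1.sub h2
  have := hmono.ge_of_tendsto hlim 0
  simp only [zero_add] at this
  linarith

/-- With `E` the shift of the index, the free recurrence factors as `(E - z⁻¹)(E - z)`. As `|z| =
1`, each factor can be summed from infinity without loss, so far out the supremum of `‖u‖` is at
most half of itself. The double root `z = ±1` needs no separate treatment. -/
theorem eventually_zero_of_perturbed_recurrence {z : ℂ} (hz : ‖z‖ = 1) {u : ℕ → ℂ}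
    (hu : Tendsto u atTop (𝓝 0)) {C r : ℝ} (hC : 0 ≤ C) (hr0 : 0 ≤ r) (hr1 : r < 1)
    (h : ∀ n, ‖u (n + 2) - (z + z⁻¹) * u (n + 1) + u n‖
      ≤ C * r ^ n * (‖u n‖ + ‖u (n + 1)‖ + ‖u (n + 2)‖)) :
    ∃ N, ∀ n ≥ N, u n = 0 := by
  have hz0 : z ≠ 0 := by rintro rfl; simp at hz
  have h1r : 0 < 1 - r := by linarith
  -- Each of the two summations costs a factor `1/(1-r)`, and `3` counts the terms of the error.
  -- From `N` on the total factor is at most `1/2`.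
  obtain ⟨N, hN⟩ : ∃ N : ℕ, ∀ n ≥ N, 3 * C / (1 - r) / (1 - r) * r ^ n ≤ 1 / 2 := by
    have := (tendsto_pow_atTop_nhds_zero_of_lt_one hr0 hr1).const_mul (3 * C / (1 - r) / (1 - r))
    rw [mul_zero] at this
    exact eventually_atTop.1 (this.eventually_le_const (by norm_num))
  have hv : Tendsto (fun n => u (n + 1) - z * u n) atTop (𝓝 0) := by
    simpa using ((tendsto_add_atTop_iff_nat 1).2 hu).sub (hu.const_mul z)
  have step : ∀ M : ℝ, (∀ n ≥ N, ‖u n‖ ≤ M) → ∀ n ≥ N, ‖u n‖ ≤ M / 2 := by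
    intro M hM
    have hM0 : 0 ≤ M := (norm_nonneg _).trans (hM N le_rfl)
    have h1 : ∀ n ≥ N, ‖u (n + 1) - z * u n‖ ≤ 3 * C * M / (1 - r) * r ^ n := by
      refine norm_le_of_le_succ_add_geometric hv hr0 hr1 fun n hn => ?_
      have e : z⁻¹ * (u (n + 1) - z * u n) = (u (n + 1 + 1) - z * u (n + 1))
          - (u (n + 2) - (z + z⁻¹) * u (n + 1) + u n) := by
        field_simp
        ring
      calc ‖u (n + 1) - z * u n‖ = ‖z⁻¹ * (u (n + 1) - z * u n)‖ := by simp [hz]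
        _ ≤ ‖u (n + 1 + 1) - z * u (n + 1)‖ + ‖u (n + 2) - (z + z⁻¹) * u (n + 1) + u n‖ := by
          rw [e]; exact norm_sub_le _ _
        _ ≤ _ := by
          gcongr
          refine (h n).trans ?_
          have a := hM n hn
          have b := hM (n + 1) (by omega)
          have c := hM (n + 2) (by omega)
          calc _ ≤ C * r ^ n * (M + M + M) := by gcongr
            _ = _ := by ring
    have h2 : ∀ n ≥ N, ‖u n‖ ≤ 3 * C * M / (1 - r) / (1 - r) * r ^ n := by
      refine norm_le_of_le_succ_add_geometric hu hr0 hr1 fun n hn => ?_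
      calc ‖u n‖ = ‖u (n + 1) - (u (n + 1) - z * u n)‖ := by simp [hz]
        _ ≤ _ := norm_sub_le _ _
        _ ≤ _ := by gcongr; exact h1 n hn
    intro n hn
    calc ‖u n‖ ≤ 3 * C * M / (1 - r) / (1 - r) * r ^ n := h2 n hn
      _ = M * (3 * C / (1 - r) / (1 - r) * r ^ n) := by ring
      _ ≤ M * (1 / 2) := by gcongr; exact hN n hn
      _ = _ := by ring
  obtain ⟨M, hM⟩ := hu.norm.bddAbove_range
  have it : ∀ k : ℕ, ∀ n ≥ N, ‖u n‖ ≤ M * (1 / 2) ^ k := by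
    intro k
    induction k with
    | zero => intro n _; simpa using hM ⟨n, rfl⟩
    | succ k ih =>
      intro n hn
      have := step _ ih n hn
      rw [pow_succ]
      linarith
  refine ⟨N, fun n hn => ?_⟩
  have hl : Tendsto (fun k : ℕ => M * (1 / 2 : ℝ) ^ k) atTop (𝓝 0) := by
    simpa using (tendsto_pow_atTop_nhds_zero_of_lt_one (r := (1 / 2 : ℝ)) (by norm_num)
      (by norm_num)).const_mul M
  exact norm_le_zero_iff.1 (ge_of_tendsto' hl fun k => it k n hn)

/-! ### The Jacobi operator of the Al-Salam–Chihara polynomials -/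

/-- The off-diagonal coefficients of the normalized Al-Salam–Chihara recurrence. -/
def ascOff (q p : ℝ) (n : ℕ) : ℝ := √((1 - q ^ (n + 1)) * (1 - p * q ^ n)) / 2

section asc
variable {q p σ : ℝ} (hq0 : 0 < q) (hq1 : q < 1) (hp0 : 0 < p) (hp1 : p < 1)
include hq0 hq1 hp0 hp1

omit hp0 hp1 in
theorem one_sub_pow_succ_mem (n : ℕ) : 0 < 1 - q ^ (n + 1) ∧ 1 - q ^ (n + 1) < 1 :=
  ⟨sub_pos.2 (pow_lt_one₀ hq0.le hq1 n.succ_ne_zero), by have := pow_pos hq0 (n + 1); linarith⟩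

theorem one_sub_mul_pow_mem (n : ℕ) : 0 < 1 - p * q ^ n ∧ 1 - p * q ^ n < 1 := by
  have h1 := pow_pos hq0 n
  have h2 := pow_le_one₀ hq0.le hq1.le (n := n)
  exact ⟨by nlinarith, by nlinarith⟩

theorem ascOff_pos (n : ℕ) : 0 < ascOff q p n :=
  half_pos (Real.sqrt_pos.2 (mul_pos (one_sub_pow_succ_mem hq0 hq1 n).1
    (one_sub_mul_pow_mem hq0 hq1 hp0 hp1 n).1))

/-- For `0 < t ≤ 1` one has `t ≤ √t ≤ 1`, so `0 ≤ 1 - √t ≤ 1 - t ≤ q^{n+1} + p qⁿ`. -/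
theorem abs_one_sub_two_mul_ascOff (n : ℕ) : |1 - 2 * ascOff q p n| ≤ 2 * q ^ n := by
  obtain ⟨a1, a2⟩ := one_sub_pow_succ_mem hq0 hq1 n
  obtain ⟨b1, b2⟩ := one_sub_mul_pow_mem hq0 hq1 hp0 hp1 n
  have e : 2 * ascOff q p n = √((1 - q ^ (n + 1)) * (1 - p * q ^ n)) := by rw [ascOff]; ring
  set t := (1 - q ^ (n + 1)) * (1 - p * q ^ n) with ht
  have t0 : 0 < t := mul_pos a1 b1
  have t1 : t ≤ 1 := mul_le_one₀ a2.le b1.le b2.le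
  have s1 : √t ≤ 1 := Real.sqrt_le_one.2 t1
  have s2 : t ≤ √t := Real.le_sqrt_of_sq_le (by nlinarith)
  have hq := pow_pos hq0 n
  have c1 : q ^ (n + 1) ≤ q ^ n := pow_le_pow_of_le_one hq0.le hq1.le n.le_succ
  have c2 : p * q ^ n ≤ q ^ n := mul_le_of_le_one_left hq.le hp1.le
  have c3 : 1 - q ^ (n + 1) - p * q ^ n ≤ t := by
    have : 0 ≤ q ^ (n + 1) * (p * q ^ n) := by positivity
    rw [ht]; linarith
  rw [e, abs_of_nonneg (by linarith)]
  linarith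

theorem norm_ascOff_le (n : ℕ) : ‖(ascOff q p n : ℂ)‖ ≤ 1 / 2 := by
  rw [Complex.norm_real, Real.norm_of_nonneg (ascOff_pos hq0 hq1 hp0 hp1 n).le, ascOff]
  gcongr
  rw [Real.sqrt_le_one]
  obtain ⟨a1, a2⟩ := one_sub_pow_succ_mem hq0 hq1 n
  obtain ⟨b1, b2⟩ := one_sub_mul_pow_mem hq0 hq1 hp0 hp1 n
  exact mul_le_one₀ a2.le b1.le b2.le

omit hp0 hp1 in
theorem norm_diag_le (σ : ℝ) (n : ℕ) : ‖((σ * q ^ n : ℝ) : ℂ)‖ ≤ |σ| := by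
  rw [Complex.norm_real, norm_mul, Real.norm_eq_abs, Real.norm_of_nonneg (pow_pos hq0 n).le]
  exact mul_le_of_le_one_right (abs_nonneg _) (pow_le_one₀ hq0.le hq1.le)

theorem tendsto_ascOff : Tendsto (ascOff q p) atTop (𝓝 (1 / 2)) := by
  have h : Tendsto (fun n : ℕ => 2 * q ^ n) atTop (𝓝 0) := by
    simpa using (tendsto_pow_atTop_nhds_zero_of_lt_one hq0.le hq1).const_mul 2
  have h1 : Tendsto (fun n => 1 - 2 * ascOff q p n) atTop (𝓝 0) :=
    squeeze_zero_norm (fun n => abs_one_sub_two_mul_ascOff hq0 hq1 hp0 hp1 n) h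
  have h2 := (h1.const_sub 1).div_const 2
  simpa using h2

/-- A solution of the recurrence at a point of `[-1, 1]` that tends to zero vanishes. -/
theorem eq_zero_of_tendsto_zero_of_recurrence {x : ℝ} (hx : x ∈ Set.Icc (-1) 1) {u : ℕ → ℂ}
    (hu : Tendsto u atTop (𝓝 0))
    -- Row `0` of the matrix is left out on purpose, so that the lemma also applies to solutions of
    -- `(x - X) u = e₀`.
    (h : ∀ n, ((σ * q ^ (n + 1) : ℝ) : ℂ) * u (n + 1) + ascOff q p (n + 1) * u (n + 2)
      + ascOff q p n * u n = x * u (n + 1)) (n : ℕ) : u n = 0 := by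
  obtain ⟨N, hN⟩ : ∃ N, ∀ n ≥ N, u n = 0 := by
    set z : ℂ := Complex.exp (Real.arccos x * Complex.I) with hz
    have hzx : z + z⁻¹ = 2 * x := by
      rw [hz, ← Complex.exp_neg, ← neg_mul, ← Complex.two_cos, ← Complex.ofReal_cos,
        Real.cos_arccos hx.1 hx.2]
    refine eventually_zero_of_perturbed_recurrence (z := z) (Complex.norm_exp_ofReal_mul_I _) hu
      (C := 2 + 2 * |σ|) (by positivity) hq0.le hq1 fun n => ?_
    have e : u (n + 2) - (z + z⁻¹) * u (n + 1) + u n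
        = ((1 - 2 * ascOff q p n : ℝ) : ℂ) * u n - 2 * ((σ * q ^ (n + 1) : ℝ) : ℂ) * u (n + 1)
          + ((1 - 2 * ascOff q p (n + 1) : ℝ) : ℂ) * u (n + 2) := by
      rw [hzx]
      push_cast
      have := h n
      push_cast at this
      linear_combination 2 * this
    have hqn := pow_pos hq0 n
    have c1 : q ^ (n + 1) ≤ q ^ n := pow_le_pow_of_le_one hq0.le hq1.le n.le_succ
    have b1 : ‖((1 - 2 * ascOff q p n : ℝ) : ℂ)‖ ≤ (2 + 2 * |σ|) * q ^ n := by
      rw [Complex.norm_real]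
      refine (abs_one_sub_two_mul_ascOff hq0 hq1 hp0 hp1 n).trans ?_
      gcongr
      linarith [abs_nonneg σ]
    have b2 : ‖((1 - 2 * ascOff q p (n + 1) : ℝ) : ℂ)‖ ≤ (2 + 2 * |σ|) * q ^ n := by
      rw [Complex.norm_real]
      refine (abs_one_sub_two_mul_ascOff hq0 hq1 hp0 hp1 (n + 1)).trans ?_
      gcongr
      linarith [abs_nonneg σ]
    have b3 : ‖2 * ((σ * q ^ (n + 1) : ℝ) : ℂ)‖ ≤ (2 + 2 * |σ|) * q ^ n := by
      rw [norm_mul, Complex.norm_real, norm_mul, Real.norm_of_nonneg (pow_pos hq0 _).le,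
        Real.norm_eq_abs, Complex.norm_ofNat, ← mul_assoc]
      gcongr
      linarith
    rw [e]
    calc
      _ ≤ ‖((1 - 2 * ascOff q p n : ℝ) : ℂ) * u n‖
          + ‖2 * ((σ * q ^ (n + 1) : ℝ) : ℂ) * u (n + 1)‖
          + ‖((1 - 2 * ascOff q p (n + 1) : ℝ) : ℂ) * u (n + 2)‖ := by
        exact (norm_add_le _ _).trans (by gcongr; exact norm_sub_le _ _)
      _ ≤ (2 + 2 * |σ|) * q ^ n * ‖u n‖ + (2 + 2 * |σ|) * q ^ n * ‖u (n + 1)‖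
          + (2 + 2 * |σ|) * q ^ n * ‖u (n + 2)‖ := by
        rw [norm_mul _ (u n), norm_mul _ (u (n + 1)), norm_mul _ (u (n + 2))]
        gcongr
      _ = _ := by ring
  -- Since `ascOff q p n` is nonzero, the recurrence can be run backwards from the zero tail.
  have down : ∀ k n, N ≤ n + k → u n = 0 := by
    intro k
    induction k with
    | zero => intro n hn; exact hN n hn
    | succ k ih =>
      intro n hn
      have h0 := h n
      rw [ih (n + 1) (by omega), ih (n + 2) (by omega)] at h0
      have ha : (ascOff q p n : ℂ) ≠ 0 := by
        exact_mod_cast (ascOff_pos hq0 hq1 hp0 hp1 n).ne'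
      simpa [ha] using h0
  exact down N n (Nat.le_add_left _ _)

omit hq0 hq1 hp0 hp1 in
/-- The Jacobi operator with diagonal `σ qⁿ` and Al-Salam–Chihara off-diagonal. -/
def ascOp (σ : ℝ) (hq0 : 0 < q) (hq1 : q < 1) (hp0 : 0 < p) (hp1 : p < 1) : H →L[ℂ] H :=
  jacobiOp (fun n => σ * q ^ n) (ascOff q p) (norm_diag_le hq0 hq1 σ)
    (norm_ascOff_le hq0 hq1 hp0 hp1)

theorem ascOp_apply_zero (u : H) :
    ascOp σ hq0 hq1 hp0 hp1 u 0 = σ * u 0 + ascOff q p 0 * u 1 := by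
  simp [ascOp, jacobiOp_apply_zero]

theorem ascOp_apply_succ (u : H) (n : ℕ) :
    ascOp σ hq0 hq1 hp0 hp1 u (n + 1) = ((σ * q ^ (n + 1) : ℝ) : ℂ) * u (n + 1)
      + ascOff q p (n + 1) * u (n + 2) + ascOff q p n * u n :=
  jacobiOp_apply_succ _ _ _ _ u n

theorem isSelfAdjoint_ascOp : IsSelfAdjoint (ascOp σ hq0 hq1 hp0 hp1) :=
  isSelfAdjoint_jacobiOp _ _ _ _

theorem eq_zero_of_ascOp_eq_smul {x : ℝ} (hx : x ∈ Set.Icc (-1) 1) {u : H}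
    (h : ascOp σ hq0 hq1 hp0 hp1 u = (x : ℂ) • u) : u = 0 := by
  ext n
  refine eq_zero_of_tendsto_zero_of_recurrence hq0 hq1 hp0 hp1 (σ := σ) hx (tendsto_coord_zero u)
    (fun n => ?_) n
  rw [← ascOp_apply_succ hq0 hq1 hp0 hp1, h]
  rfl

theorem not_hasEigenvalue_ascOp {x : ℝ} (hx : x ∈ Set.Icc (-1) 1) :
    ¬ Module.End.HasEigenvalue (ascOp σ hq0 hq1 hp0 hp1 : H →ₗ[ℂ] H) x := by
  intro h
  obtain ⟨u, hu⟩ := h.exists_hasEigenvector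
  exact hu.2 (eq_zero_of_ascOp_eq_smul hq0 hq1 hp0 hp1 hx hu.apply_eq_smul)

/-- A preimage of `e₀` under `x - X` would solve the homogeneous recurrence in all rows but the
first. It decays, so it vanishes, which is absurd. -/
theorem mem_spectrum_ascOp {x : ℝ} (hx : x ∈ Set.Icc (-1) 1) :
    (x : ℂ) ∈ spectrum ℂ (ascOp σ hq0 hq1 hp0 hp1) := by
  intro h
  obtain ⟨R, hR⟩ := h
  set u : H := (↑R⁻¹ : H →L[ℂ] H) (lp.single 2 0 1) with hu
  have h1 : (algebraMap ℂ (H →L[ℂ] H) x - ascOp σ hq0 hq1 hp0 hp1) u = lp.single 2 0 1 := by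
    rw [← hR, hu, ← mul_apply_eq_comp, Units.mul_inv, one_apply_eq_self]
  have h2 : ∀ n, u n = 0 := by
    refine eq_zero_of_tendsto_zero_of_recurrence hq0 hq1 hp0 hp1 (σ := σ) hx
      (tendsto_coord_zero u) fun n => ?_
    rw [← ascOp_apply_succ hq0 hq1 hp0 hp1]
    have := congrArg (fun v : H => v (n + 1)) h1
    simp only [sub_apply, lp.coeFn_sub, Pi.sub_apply, Algebra.algebraMap_eq_smul_one] at this
    simp [lp.single_apply] at this
    exact (sub_eq_zero.1 this).symm
  have h3 : u = 0 := by ext n; exact h2 n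
  rw [h3, map_zero] at h1
  have := congrArg (fun v : H => v 0) h1
  simp at this

theorem hasEigenvalue_ascOp_of_mem_spectrum {z : ℂ}
    (hz : z ∈ spectrum ℂ (ascOp σ hq0 hq1 hp0 hp1))
    (hz0 : ¬ ∃ x : ℝ, x ∈ Set.Icc (-1) 1 ∧ z = x) :
    Module.End.HasEigenvalue (ascOp σ hq0 hq1 hp0 hp1 : H →ₗ[ℂ] H) z := by
  refine exists_eigenvector_of_mem_spectrum_jacobiOp _ _ _ _ ?_
    (tendsto_ascOff hq0 hq1 hp0 hp1) hz hz0
  simpa using (tendsto_pow_atTop_nhds_zero_of_lt_one hq0.le hq1).const_mul σ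

/-- When `2σ ≤ 1 + p`, all eigenvalues lie in `[-1, 1]`. -/
theorem norm_le_one_of_ascOp_eq_smul (hσ0 : 0 ≤ σ) (hσ : 2 * σ ≤ 1 + p) {z : ℂ} {u : H}
    (hu : u ≠ 0) (h : ascOp σ hq0 hq1 hp0 hp1 u = z • u) : ‖z‖ ≤ 1 := by
  set s : ℕ → ℝ := fun n => ‖u n‖ ^ 2 with hs
  have s0 : ∀ n, 0 ≤ s n := fun n => by positivity
  have hsum : Summable s := summable_norm_sq u
  set f : ℕ → ℝ := fun n => (1 - q ^ n) * s n with hf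
  set g : ℕ → ℝ := fun n => (1 - p * q ^ n) * s n with hg
  have hpow : ∀ n, 0 < q ^ n ∧ q ^ n ≤ 1 := fun n => ⟨pow_pos hq0 n, pow_le_one₀ hq0.le hq1.le⟩
  have f0 : ∀ n, 0 ≤ f n ∧ f n ≤ s n := fun n =>
    ⟨mul_nonneg (by linarith [hpow n]) (s0 n), mul_le_of_le_one_left (s0 n) (by linarith [hpow n])⟩
  have g0 : ∀ n, 0 ≤ g n ∧ g n ≤ s n := fun n => by
    obtain ⟨b1, b2⟩ := one_sub_mul_pow_mem hq0 hq1 hp0 hp1 n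
    exact ⟨mul_nonneg b1.le (s0 n), mul_le_of_le_one_left (s0 n) b2.le⟩
  have hfs : Summable f := .of_nonneg_of_le (fun n => (f0 n).1) (fun n => (f0 n).2) hsum
  have hgs : Summable g := .of_nonneg_of_le (fun n => (g0 n).1) (fun n => (g0 n).2) hsum
  set d : ℕ → ℝ := fun n => σ * q ^ n * s n with hd
  have hds : Summable d := by
    refine .of_nonneg_of_le (fun n => ?_) (fun n => ?_) (hsum.mul_left σ)
    · exact mul_nonneg (mul_nonneg hσ0 (hpow n).1.le) (s0 n)
    · rw [hd]
      exact mul_le_mul_of_nonneg_right (mul_le_of_le_one_right hσ0 (hpow n).2) (s0 n)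
  -- The factor `1 - q^{n+1}` is attached to `u (n + 1)` and `1 - p qⁿ` to `u n`. The weight of `f`
  -- then vanishes at `0`, so no boundary term remains when the rows are summed.
  have amgm : ∀ n, ascOff q p n * (‖u n‖ * ‖u (n + 1)‖) ≤ (f (n + 1) + g n) / 4 := by
    intro n
    obtain ⟨a1, -⟩ := one_sub_pow_succ_mem hq0 hq1 n
    obtain ⟨b1, -⟩ := one_sub_mul_pow_mem hq0 hq1 hp0 hp1 n
    have e1 := Real.sq_sqrt a1.le
    have e2 := Real.sq_sqrt b1.le
    have := sq_nonneg (√(1 - q ^ (n + 1)) * ‖u (n + 1)‖ - √(1 - p * q ^ n) * ‖u n‖)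
    simp only [hf, hg, hs, ascOff, Real.sqrt_mul a1.le]
    rw [← e1, ← e2, Real.sqrt_sq (Real.sqrt_nonneg _), Real.sqrt_sq (Real.sqrt_nonneg _)]
    nlinarith
  have aoff := fun n => (ascOff_pos hq0 hq1 hp0 hp1 n).le
  have nrm : ∀ n, ‖((σ * q ^ n : ℝ) : ℂ)‖ = σ * q ^ n := fun n => by
    rw [Complex.norm_real, Real.norm_of_nonneg (mul_nonneg hσ0 (hpow n).1.le)]
  have nra : ∀ n, ‖(ascOff q p n : ℂ)‖ = ascOff q p n := fun n => by
    rw [Complex.norm_real, Real.norm_of_nonneg (aoff n)]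
  have z0 : ‖z‖ * s 0 ≤ d 0 + (f 1 + g 0) / 4 := by
    have h0 : z * u 0 = ((σ * q ^ 0 : ℝ) : ℂ) * u 0 + ascOff q p 0 * u 1 := by
      rw [pow_zero, mul_one, ← ascOp_apply_zero hq0 hq1 hp0 hp1, h]; simp
    have h1 : ‖z‖ * ‖u 0‖ ≤ σ * q ^ 0 * ‖u 0‖ + ascOff q p 0 * ‖u 1‖ := by
      rw [← norm_mul, h0]
      refine (norm_add_le _ _).trans_eq ?_
      rw [norm_mul, norm_mul, nrm, nra]
    have h2 := mul_le_mul_of_nonneg_right h1 (norm_nonneg (u 0))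
    have h3 := amgm 0
    simp only [hd, hs]
    linarith
  have zs : ∀ n, ‖z‖ * s (n + 1) ≤ d (n + 1) + (f (n + 2) + g (n + 1)) / 4
      + (f (n + 1) + g n) / 4 := by
    intro n
    have h0 : z * u (n + 1) = ((σ * q ^ (n + 1) : ℝ) : ℂ) * u (n + 1)
        + ascOff q p (n + 1) * u (n + 2) + ascOff q p n * u n := by
      rw [← ascOp_apply_succ hq0 hq1 hp0 hp1, h]; simp
    have h1 : ‖z‖ * ‖u (n + 1)‖ ≤ σ * q ^ (n + 1) * ‖u (n + 1)‖
        + ascOff q p (n + 1) * ‖u (n + 2)‖ + ascOff q p n * ‖u n‖ := by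
      rw [← norm_mul, h0]
      refine norm_add₃_le.trans_eq ?_
      rw [norm_mul, norm_mul, norm_mul, nrm, nra, nra]
    have h2 := mul_le_mul_of_nonneg_right h1 (norm_nonneg (u (n + 1)))
    have h3 := amgm n
    have h4 := amgm (n + 1)
    simp only [hd, hs]
    linarith
  have shift : ∀ {w : ℕ → ℝ}, Summable w → Summable fun n => w (n + 1) :=
    fun hw => (summable_nat_add_iff 1).2 hw
  have total : ‖z‖ * ∑' n, s n ≤ (∑' n, d n) + (∑' n, f n) / 2 + (∑' n, g n) / 2 := by
    have hle := ((shift hsum).mul_left ‖z‖).tsum_le_tsum zs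
      (((shift hds).add (((shift (shift hfs)).add (shift hgs)).div_const 4)).add
        (((shift hfs).add hgs).div_const 4))
    rw [((shift hds).add (((shift (shift hfs)).add (shift hgs)).div_const 4)).tsum_add
        (((shift hfs).add hgs).div_const 4),
      (shift hds).tsum_add (((shift (shift hfs)).add (shift hgs)).div_const 4),
      tsum_div_const, tsum_div_const, (shift (shift hfs)).tsum_add (shift hgs),
      (shift hfs).tsum_add hgs, tsum_mul_left] at hle
    have e1 := hsum.tsum_eq_zero_add
    have e2 := hds.tsum_eq_zero_add
    have e3 := hfs.tsum_eq_zero_add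
    have e4 := hgs.tsum_eq_zero_add
    have e5 := (shift hfs).tsum_eq_zero_add
    have e6 : f 0 = 0 := by simp [hf]
    simp only [zero_add] at e5
    rw [e1, mul_add]
    linarith
  -- The total weight of `s n` is `σ qⁿ + (1 - qⁿ)/2 + (1 - p qⁿ)/2 = 1 - (1 + p - 2σ) qⁿ/2`, at
  -- most `1` by `hσ`.
  have fin : (∑' n, d n) + (∑' n, f n) / 2 + (∑' n, g n) / 2 ≤ ∑' n, s n := by
    rw [← tsum_div_const, ← tsum_div_const, ← hds.tsum_add (hfs.div_const 2),
      ← (hds.add (hfs.div_const 2)).tsum_add (hgs.div_const 2)]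
    refine ((hds.add (hfs.div_const 2)).add (hgs.div_const 2)).tsum_le_tsum (fun n => ?_) hsum
    have : 0 ≤ (1 + p - 2 * σ) * (q ^ n * s n) :=
      mul_nonneg (by linarith) (mul_nonneg (hpow n).1.le (s0 n))
    simp only [hd, hf, hg]
    linarith
  have pos : 0 < ∑' n, s n := by
    rw [hs, ← norm_sq_eq_tsum]
    have := norm_pos_iff.2 hu
    positivity
  by_contra hcon
  push Not at hcon
  nlinarith

end asc

/-! ### The infinite product `(a; q)_∞` -/

section qPoch
variable {q : ℝ} (hq0 : 0 < q) (hq1 : q < 1)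
include hq0 hq1

theorem summable_norm_mul_pow (a : ℂ) : Summable fun r : ℕ => ‖-(a * (q : ℂ) ^ r)‖ := by
  have := (summable_geometric_of_lt_one hq0.le hq1).mul_left ‖a‖
  refine this.congr fun r => ?_
  simp [abs_of_pos hq0]

theorem qPochInf_eq_mul (a : ℂ) : qPochInf a q = (1 - a) * qPochInf (a * q) q := by
  have h : Multipliable fun r : ℕ => 1 - a * (q : ℂ) ^ (r + 1) := by
    have := multipliable_one_add_of_summable (summable_norm_mul_pow hq0 hq1 (a * q))
    refine this.congr fun r => ?_
    rw [pow_succ']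
    ring
  have h1 : qPochInf a q = (1 - a * (q : ℂ) ^ 0) * ∏' r : ℕ, (1 - a * (q : ℂ) ^ (r + 1)) :=
    tprod_eq_zero_mul' (f := fun r : ℕ => 1 - a * (q : ℂ) ^ r) h
  rw [h1, pow_zero, mul_one, qPochInf]
  congr 1
  refine tprod_congr fun r => ?_
  rw [pow_succ']
  ring

theorem qPochInf_ne_zero {a : ℂ} (ha : ‖a‖ < 1) : qPochInf a q ≠ 0 := by
  have := tprod_one_add_ne_zero_of_summable (f := fun r : ℕ => -(a * (q : ℂ) ^ r)) (fun r => ?_)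
    (summable_norm_mul_pow hq0 hq1 a)
  · simpa [qPochInf, sub_eq_add_neg] using this
  · intro h
    have h1 : a * (q : ℂ) ^ r = 1 := by linear_combination -h
    have h2 : ‖a * (q : ℂ) ^ r‖ < 1 := by
      rw [norm_mul, norm_pow, Complex.norm_real, Real.norm_of_nonneg hq0.le]
      exact mul_lt_one_of_nonneg_of_lt_one_left (norm_nonneg _) ha (pow_le_one₀ hq0.le hq1.le)
    rw [h1, norm_one] at h2
    exact lt_irrefl _ h2

omit hq0 hq1 in
@[simp] theorem qPochInf_zero : qPochInf 0 q = 1 := by simp [qPochInf]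

/-- On a ball around `a` the geometric majorant makes the product converge locally uniformly. -/
theorem differentiable_qPochInf : Differentiable ℂ fun a => qPochInf a q := by
  intro a
  have hs : Summable fun r : ℕ => (‖a‖ + 1) * q ^ r :=
    (summable_geometric_of_lt_one hq0.le hq1).mul_left _
  have h := Summable.hasProdLocallyUniformlyOn_nat_one_add (K := Metric.ball (0 : ℂ) (‖a‖ + 1))
    (f := fun (r : ℕ) x => -(x * (q : ℂ) ^ r)) Metric.isOpen_ball hs
    (.of_forall fun r x hx => by
      rw [norm_neg, norm_mul, norm_pow, Complex.norm_real, Real.norm_of_nonneg hq0.le]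
      gcongr
      exact (mem_ball_zero_iff.1 hx).le) (fun r => by fun_prop)
  have hd := h.differentiableOn (.of_forall fun s => by
    simpa [Finset.prod_fn] using DifferentiableOn.finsetProd (fun _ _ => by fun_prop))
    Metric.isOpen_ball
  have := hd.differentiableAt (Metric.isOpen_ball.mem_nhds
    (mem_ball_zero_iff.2 (lt_add_one ‖a‖)))
  simpa [qPochInf, sub_eq_add_neg] using this

end qPoch

/-! ### Power series expansions in a disc -/

theorem HasExpansion.unique {f : ℂ → ℂ} {F G : PowerSeries ℂ} {R : ℝ} (hR : 0 < R)
    (hF : HasExpansion f F R) (hG : HasExpansion f G R) : F = G := by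
  have key : ∀ {F : PowerSeries ℂ}, HasExpansion f F R →
      HasFPowerSeriesAt f (.ofScalars ℂ fun n => PowerSeries.coeff n F) 0 := by
    intro F hF
    rw [hasFPowerSeriesAt_iff]
    filter_upwards [Metric.ball_mem_nhds (0 : ℂ) hR] with x hx
    have := hF x (mem_ball_zero_iff.1 hx)
    simpa [FormalMultilinearSeries.coeff_ofScalars, mul_comm] using this
  have h := (key hF).eq_formalMultilinearSeries (key hG)
  ext n
  have := congrArg (fun p => FormalMultilinearSeries.coeff p n) h
  simpa [FormalMultilinearSeries.coeff_ofScalars] using this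

/-- This and the next two lemmas translate the ingredients of the `q`-difference equation of `ξ`
into operations on power series. -/
theorem HasExpansion.X_mul {f : ℂ → ℂ} {F : PowerSeries ℂ} {R : ℝ} (hF : HasExpansion f F R) :
    HasExpansion (fun x => x * f x) (PowerSeries.X * F) R := by
  intro x hx
  rw [← hasSum_nat_add_iff' 1]
  have := (hF x hx).mul_left x
  simp only [PowerSeries.coeff_succ_X_mul, Finset.range_one, Finset.sum_singleton,
    PowerSeries.coeff_zero_X_mul, zero_mul, sub_zero]
  refine this.congr_fun fun n => ?_
  ring

theorem HasExpansion.one_sub_mul {f : ℂ → ℂ} {F : PowerSeries ℂ} {R : ℝ}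
    (hF : HasExpansion f F R) (c : ℂ) :
    HasExpansion (fun x => (1 - c * x) * f x) (F - c • (PowerSeries.X * F)) R := by
  intro x hx
  have := (hF x hx).sub ((hF.X_mul x hx).mul_left c)
  have e : (1 - c * x) * f x = f x - c * (x * f x) := by ring
  beta_reduce
  rw [e]
  refine this.congr_fun fun n => ?_
  simp
  ring

theorem HasExpansion.comp_mul {f : ℂ → ℂ} {F : PowerSeries ℂ} {R : ℝ} (hF : HasExpansion f F R)
    {c : ℂ} (hc : ‖c‖ ≤ 1) :
    HasExpansion (fun x => f (c * x)) (PowerSeries.rescale c F) R := by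
  intro x hx
  have := hF (c * x) (by
    rw [norm_mul]; exact (mul_le_of_le_one_left (norm_nonneg _) hc).trans_lt hx)
  refine this.congr_fun fun n => ?_
  rw [PowerSeries.coeff_rescale]
  ring

theorem HasExpansion.congr {f g : ℂ → ℂ} {F : PowerSeries ℂ} {R : ℝ} (hF : HasExpansion f F R)
    (h : ∀ x, ‖x‖ < R → g x = f x) : HasExpansion g F R := fun x hx => by
  rw [h x hx]; exact hF x hx

theorem exists_hasExpansion {f : ℂ → ℂ} {R : ℝ}
    (hf : DifferentiableOn ℂ f (Metric.ball 0 R)) : ∃ F, HasExpansion f F R := by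
  refine ⟨PowerSeries.mk fun n => (n.factorial : ℂ)⁻¹ * iteratedDeriv n f 0, fun x hx => ?_⟩
  have := Complex.hasSum_taylorSeries_on_ball hf (mem_ball_zero_iff.2 hx)
  refine this.congr_fun fun n => ?_
  simp
  ring

/-! ### The operator `I₁` on coefficients -/

/-- `β = q^{1/2} / (1 - q)`, half the length of the continuous spectrum. -/
def specScale (q : ℝ) : ℝ := q ^ (1 / 2 : ℝ) / (1 - q)

/-- `q^{(1-2l)/4}`, the inverse of the radius of the disc of analyticity. -/
def invRadius (q l : ℝ) : ℝ := q ^ ((1 - 2 * l) / 4)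

/-- Half the sum of the two Al-Salam–Chihara parameters `q^{l+1/4}` and `q^{l-1/4}`. -/
def halfSum (q l : ℝ) : ℝ := (q ^ (1 / 4 : ℝ) + q ^ (-(1 / 4) : ℝ)) / 2 * q ^ l

section coeff
variable {q : ℝ} (hq0 : 0 < q)
include hq0

theorem invRadius_pos (l : ℝ) : 0 < invRadius q l := Real.rpow_pos_of_pos hq0 _

theorem halfSum_pos (l : ℝ) : 0 < halfSum q l := by unfold halfSum; positivity

theorem bConst_eq : bConst q = -specScale q := by
  have h1 : q ^ (1 / 2 : ℝ) - q ^ (-(1 / 2) : ℝ) = -(1 - q) / q ^ (1 / 2 : ℝ) := by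
    have h := Real.rpow_add hq0 (1 / 2) (1 / 2)
    have hp : 0 < q ^ (1 / 2 : ℝ) := Real.rpow_pos_of_pos hq0 _
    norm_num at h
    rw [Real.rpow_neg hq0.le]
    norm_num
    field_simp
    norm_num at h hp ⊢
    linarith
  rw [bConst, h1, specScale, inv_div, div_neg]

theorem eigval_eq (ν : ℝ) : eigval q ν = specScale q * (1 - ν) := by
  have h := bConst_eq hq0
  rw [bConst] at h
  rw [eigval, div_eq_mul_inv, ← neg_sub (q ^ (1 / 2 : ℝ)), inv_neg, h]
  ring

theorem qNum_eq (t : ℝ) : qNum q t = q ^ ((1 - t) / 2) * (1 - q ^ t) / (1 - q) := by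
  have h := bConst_eq hq0
  rw [bConst, specScale] at h
  rw [qNum, div_eq_mul_inv, h]
  have e1 : q ^ (t / 2) = q ^ (-t / 2) * q ^ t := by rw [← Real.rpow_add hq0]; congr 1; ring
  have e2 : q ^ ((1 - t) / 2) = q ^ (-t / 2) * q ^ (1 / 2 : ℝ) := by
    rw [← Real.rpow_add hq0]; congr 1; ring
  rw [e1, e2]
  ring

theorem qNum_nat (n : ℕ) : qNum q (n + 1) = q ^ (-(n : ℝ) / 2) * (1 - q ^ (n + 1)) / (1 - q) := by
  rw [qNum_eq hq0, ← Nat.cast_succ, Real.rpow_natCast]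
  congr 3
  push_cast; ring

theorem qNum_two_mul_add (l : ℝ) (n : ℕ) : qNum q (2 * l + n)
    = invRadius q l ^ 2 * q ^ (-(n : ℝ) / 2) * (1 - q ^ (2 * l) * q ^ n) / (1 - q) := by
  rw [qNum_eq hq0, Real.rpow_add hq0, Real.rpow_natCast, invRadius, ← Real.rpow_natCast _ 2,
    ← Real.rpow_mul hq0.le, ← Real.rpow_add hq0]
  congr 3
  push_cast; ring

theorem rpow_add_nat (l : ℝ) (n : ℕ) : q ^ (l + n) = q ^ l * q ^ n := by
  rw [Real.rpow_add hq0, Real.rpow_natCast]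

theorem diag_coeff (l : ℝ) (n : ℕ) :
    aConst q / 2 * q ^ (1 * (l + n)) - bConst q
      = specScale q * (1 - halfSum q l * q ^ n) := by
  rw [aConst, bConst_eq hq0, one_mul, rpow_add_nat hq0, halfSum]
  ring

/-- The two factors `q^{J₀/4}` cancel the growth `q^{-n/2}` of the `q`-numbers. Hence the matrix
entries stay bounded. -/
theorem raise_coeff (l : ℝ) (n : ℕ) :
    q ^ (1 / 4 * (l + (n + 1 : ℕ))) * (qNum q (l + n + l) * q ^ (1 / 4 * (l + n)))
      = specScale q * invRadius q l * (1 - q ^ (2 * l) * q ^ n) := by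
  rw [show l + n + l = 2 * l + n by ring, qNum_two_mul_add hq0, specScale]
  have e : q ^ (1 / 4 * (l + (n + 1 : ℕ))) * q ^ (-(n : ℝ) / 2) * q ^ (1 / 4 * (l + n))
      * invRadius q l = q ^ (1 / 2 : ℝ) := by
    rw [invRadius, ← Real.rpow_add hq0, ← Real.rpow_add hq0, ← Real.rpow_add hq0]
    congr 1
    push_cast; ring
  rw [← e]
  ring

theorem lower_coeff (l : ℝ) (n : ℕ) :
    q ^ (1 / 4 * (l + n)) * (qNum q (l + (n + 1 : ℕ) - l) * q ^ (1 / 4 * (l + (n + 1 : ℕ))))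
      = specScale q * (invRadius q l)⁻¹ * (1 - q ^ (n + 1)) := by
  rw [show l + (n + 1 : ℕ) - l = n + 1 by push_cast; ring, qNum_nat hq0, specScale]
  have e : q ^ (1 / 4 * (l + (n + 1 : ℕ))) * q ^ (-(n : ℝ) / 2) * q ^ (1 / 4 * (l + n))
      = q ^ (1 / 2 : ℝ) * (invRadius q l)⁻¹ := by
    rw [invRadius, ← Real.rpow_neg hq0.le, ← Real.rpow_add hq0, ← Real.rpow_add hq0,
      ← Real.rpow_add hq0]
    congr 1
    push_cast; ring
  calc _ = (q ^ (1 / 4 * (l + (n + 1 : ℕ))) * q ^ (-(n : ℝ) / 2) * q ^ (1 / 4 * (l + n)))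
        * (1 - q ^ (n + 1)) / (1 - q) := by ring
    _ = _ := by rw [e]; ring

theorem coeff_zero_I1 (l : ℝ) (f : PowerSeries ℂ) :
    PowerSeries.coeff 0 (I1 q l f) = specScale q * ((1 - halfSum q l) * PowerSeries.coeff 0 f
      - (invRadius q l)⁻¹ * (1 - q) / 2 * PowerSeries.coeff 1 f) := by
  have h1 := congrArg (fun t : ℝ => (t : ℂ)) (diag_coeff hq0 l 0)
  have h2 := congrArg (fun t : ℝ => (t : ℂ)) (lower_coeff hq0 l 0)
  simp only [I1, qPowJ0, J1, Jplus, Jminus, mulX, divX, funJ0, LinearMap.sub_apply,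
    LinearMap.smul_apply, LinearMap.comp_apply, LinearMap.add_apply, LinearMap.coe_mk,
    AddHom.coe_mk, LinearMap.mulLeft_apply, map_sub, map_add, map_smul, PowerSeries.coeff_mk,
    PowerSeries.coeff_zero_X_mul, smul_eq_mul, LinearMap.id_apply]
  push_cast at h1 h2 ⊢
  simp only [pow_one, pow_zero] at h1 h2 ⊢
  linear_combination PowerSeries.coeff 0 f * h1 - (1 / 2) * PowerSeries.coeff 1 f * h2

theorem coeff_succ_I1 (l : ℝ) (f : PowerSeries ℂ) (n : ℕ) :
    PowerSeries.coeff (n + 1) (I1 q l f) = specScale q *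
      ((1 - halfSum q l * q ^ (n + 1)) * PowerSeries.coeff (n + 1) f
        - (invRadius q l)⁻¹ * (1 - q ^ (n + 2)) / 2 * PowerSeries.coeff (n + 2) f
        - invRadius q l * (1 - (q ^ (2 * l) : ℝ) * q ^ n) / 2 * PowerSeries.coeff n f) := by
  have h1 := congrArg (fun t : ℝ => (t : ℂ)) (diag_coeff hq0 l (n + 1))
  have h2 := congrArg (fun t : ℝ => (t : ℂ)) (lower_coeff hq0 l (n + 1))
  have h3 := congrArg (fun t : ℝ => (t : ℂ)) (raise_coeff hq0 l n)
  simp only [I1, qPowJ0, J1, Jplus, Jminus, mulX, divX, funJ0, LinearMap.sub_apply,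
    LinearMap.smul_apply, LinearMap.comp_apply, LinearMap.add_apply, LinearMap.coe_mk,
    AddHom.coe_mk, LinearMap.mulLeft_apply, map_sub, map_add, map_smul, PowerSeries.coeff_mk,
    PowerSeries.coeff_succ_X_mul, smul_eq_mul, LinearMap.id_apply]
  push_cast at h1 h2 h3 ⊢
  linear_combination PowerSeries.coeff (n + 1) f * h1
    - (1 / 2) * PowerSeries.coeff (n + 2) f * h2 - (1 / 2) * PowerSeries.coeff n f * h3

variable (hq1 : q < 1)
include hq1

theorem specScale_pos : 0 < specScale q :=
  div_pos (Real.rpow_pos_of_pos hq0 _) (sub_pos.2 hq1)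

/-- An eigenseries of `I₁` is determined by its constant term. -/
theorem eq_zero_of_I1_eq_smul {l : ℝ} {μ : ℂ} {f : PowerSeries ℂ} (h : I1 q l f = μ • f)
    (h0 : PowerSeries.coeff 0 f = 0) : f = 0 := by
  have hb : (specScale q : ℂ) ≠ 0 := by exact_mod_cast (specScale_pos hq0 hq1).ne'
  have hs : (invRadius q l : ℂ) ≠ 0 := by exact_mod_cast (invRadius_pos hq0 l).ne'
  have hn : ∀ n : ℕ, (1 - (q : ℂ) ^ (n + 1)) ≠ 0 := fun n => by
    exact_mod_cast (one_sub_pow_succ_mem hq0 hq1 n).1.ne'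
  -- In each row the highest coefficient carries a nonzero factor, so two consecutive zeros
  -- propagate upwards.
  suffices H : ∀ n, PowerSeries.coeff n f = 0 ∧ PowerSeries.coeff (n + 1) f = 0 by
    ext n; simpa using (H n).1
  intro n
  induction n with
  | zero =>
    refine ⟨h0, ?_⟩
    have h1 := congrArg (PowerSeries.coeff 0) h
    rw [coeff_zero_I1 hq0, map_smul, h0] at h1
    have := hn 0
    simp only [zero_add, pow_one] at this
    simpa [hb, hs, this] using h1
  | succ n ih =>
    refine ⟨ih.2, ?_⟩
    have h1 := congrArg (PowerSeries.coeff (n + 1)) h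
    rw [coeff_succ_I1 hq0, map_smul, ih.1, ih.2] at h1
    simpa [hb, hs, hn (n + 1)] using h1

/-! ### The eigenfunctions -/

omit hq1 in
theorem invRadius_mul_norm_lt {l : ℝ} {x : ℂ} (hx : ‖x‖ < q ^ ((2 * l - 1) / 4)) :
    invRadius q l * ‖x‖ < 1 := by
  have e : invRadius q l * q ^ ((2 * l - 1) / 4) = 1 := by
    rw [invRadius, ← Real.rpow_add hq0, ← Real.rpow_zero q]
    congr 1; ring
  rw [← e]
  exact mul_lt_mul_of_pos_left hx (invRadius_pos hq0 l)

theorem qPochInf_invRadius_ne_zero {l : ℝ} {x c : ℂ} (hx : ‖x‖ < q ^ ((2 * l - 1) / 4))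
    (hc : ‖c‖ = 1) : qPochInf ((q ^ ((1 - 2 * l) / 4) : ℝ) * c * x) q ≠ 0 := by
  refine qPochInf_ne_zero hq0 hq1 ?_
  rw [norm_mul, norm_mul, hc, Complex.norm_real,
    Real.norm_of_nonneg (Real.rpow_pos_of_pos hq0 _).le, mul_one]
  exact invRadius_mul_norm_lt hq0 hx

omit hq0 hq1 in
theorem norm_exp_I_mul (θ : ℝ) : ‖Complex.exp (Complex.I * θ)‖ = 1 := by
  rw [mul_comm]; exact Complex.norm_exp_ofReal_mul_I θ

omit hq0 hq1 in
theorem norm_exp_neg_I_mul (θ : ℝ) : ‖Complex.exp (-(Complex.I * θ))‖ = 1 := by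
  rw [Complex.exp_neg, norm_inv, norm_exp_I_mul, inv_one]

theorem differentiableOn_xi (l θ : ℝ) :
    DifferentiableOn ℂ (xi q l θ) (Metric.ball 0 (q ^ ((2 * l - 1) / 4))) := by
  intro x hx
  have hx' := mem_ball_zero_iff.1 hx
  have hc : ∀ c : ℂ, DifferentiableAt ℂ (fun x => qPochInf (c * x) q) x := fun c =>
    (differentiable_qPochInf hq0 hq1 (c * x)).comp x
      (by fun_prop : DifferentiableAt ℂ (fun x : ℂ => c * x) x)
  refine DifferentiableAt.differentiableWithinAt ?_
  exact ((hc _).mul (hc _)).div ((hc _).mul (hc _))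
    (mul_ne_zero (qPochInf_invRadius_ne_zero hq0 hq1 hx' (norm_exp_I_mul θ))
      (qPochInf_invRadius_ne_zero hq0 hq1 hx' (norm_exp_neg_I_mul θ)))

/-- Peeling off the first factor of each of the four infinite products relates `ξ(x)` to `ξ(qx)`.
Clearing denominators leaves quadratic polynomials on both sides, hence a three-term recurrence. -/
theorem xi_functional_equation (l θ : ℝ) {x : ℂ} (hx : ‖x‖ < q ^ ((2 * l - 1) / 4)) :
    (1 - invRadius q l * Complex.exp (-(Complex.I * θ)) * x)
        * ((1 - invRadius q l * Complex.exp (Complex.I * θ) * x) * xi q l θ x)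
      = (1 - (q ^ ((l + 1) / 2) : ℝ) * x)
        * ((1 - (q ^ (l / 2) : ℝ) * x) * xi q l θ (q * x)) := by
  have hD1 := qPochInf_invRadius_ne_zero hq0 hq1 hx (norm_exp_I_mul θ)
  have hD2 := qPochInf_invRadius_ne_zero hq0 hq1 hx (norm_exp_neg_I_mul θ)
  have h : ∀ c : ℂ, qPochInf (c * x) q = (1 - c * x) * qPochInf (c * (q * x)) q := fun c => by
    rw [qPochInf_eq_mul hq0 hq1]; congr 2; ring
  rw [h] at hD1 hD2
  have h1 := left_ne_zero_of_mul hD1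
  have h2 := left_ne_zero_of_mul hD2
  have h3 := right_ne_zero_of_mul hD1
  have h4 := right_ne_zero_of_mul hD2
  unfold xi
  rw [h _, h _, h _, h _]
  have alg : ∀ a b c d A B C D : ℂ, c ≠ 0 → d ≠ 0 → C ≠ 0 → D ≠ 0 →
      d * (c * (a * A * (b * B) / (c * C * (d * D)))) = b * (a * (A * B / (C * D))) := by
    intros; field_simp
  exact alg _ _ _ _ _ _ _ _ h1 h2 h3 h4

/-- The expansion of `ξ` in its disc of analyticity is an eigenseries of `I₁`. -/
theorem exists_expansion_xi (l θ : ℝ) : ∃ F : PowerSeries ℂ, PowerSeries.coeff 0 F = 1 ∧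
    HasExpansion (xi q l θ) F (q ^ ((2 * l - 1) / 4)) ∧
    I1 q l F = (eigval q (Real.cos θ) : ℂ) • F := by
  obtain ⟨F, hF⟩ := exists_hasExpansion (differentiableOn_xi hq0 hq1 l θ)
  have hR : 0 < q ^ ((2 * l - 1) / 4) := Real.rpow_pos_of_pos hq0 _
  have hF0 : PowerSeries.coeff 0 F = 1 := by
    have h1 := hF 0 (by simpa using hR)
    have h2 := hasSum_single (f := fun n : ℕ => PowerSeries.coeff n F * (0 : ℂ) ^ n) 0
      (fun n hn => by simp [hn])
    have h3 := h1.unique h2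
    simpa [xi] using h3.symm
  refine ⟨F, hF0, hF, ?_⟩
  set e₁ : ℂ := invRadius q l * Complex.exp (Complex.I * θ) with he₁
  set e₂ : ℂ := invRadius q l * Complex.exp (-(Complex.I * θ)) with he₂
  set A : ℂ := ((q ^ (l / 2) : ℝ) : ℂ) with hA
  set B : ℂ := ((q ^ ((l + 1) / 2) : ℝ) : ℂ) with hB
  have key := HasExpansion.unique hR
    (((hF.one_sub_mul e₁).one_sub_mul e₂).congr fun x hx => by
      exact (xi_functional_equation hq0 hq1 l θ hx).symm)
    (((hF.comp_mul (c := q) (by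
      rw [Complex.norm_real, Real.norm_of_nonneg hq0.le]; exact hq1.le)).one_sub_mul A).one_sub_mul
        B)
  have s0 : (invRadius q l : ℂ) ≠ 0 := by exact_mod_cast (invRadius_pos hq0 l).ne'
  -- The quadratics enter only through the sums and products of their parameters: `e₁, e₂` give `ν`,
  -- while `A, B` give `halfSum q l` and `q^{2l}`.
  have hsum : e₁ + e₂ = 2 * invRadius q l * Real.cos θ := by
    have := Complex.two_cos θ
    rw [he₁, he₂, Complex.ofReal_cos, mul_right_comm, this, mul_comm Complex.I]
    ring_nf
  have hprod : e₁ * e₂ = (invRadius q l : ℂ) ^ 2 := by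
    rw [he₁, he₂, mul_mul_mul_comm, ← Complex.exp_add]
    simp [sq]
  have hAB : A + B = 2 * invRadius q l * halfSum q l := by
    rw [hA, hB]
    have : q ^ (l / 2) + q ^ ((l + 1) / 2) = 2 * invRadius q l * halfSum q l := by
      have h1 : q ^ ((l + 1) / 2) = invRadius q l * (q ^ (1 / 4 : ℝ) * q ^ l) := by
        rw [invRadius, ← Real.rpow_add hq0, ← Real.rpow_add hq0]; congr 1; ring
      have h2 : q ^ (l / 2) = invRadius q l * (q ^ (-(1 / 4) : ℝ) * q ^ l) := by
        rw [invRadius, ← Real.rpow_add hq0, ← Real.rpow_add hq0]; congr 1; ring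
      rw [h1, h2, halfSum]; ring
    exact_mod_cast this
  have hABp : A * B = (invRadius q l : ℂ) ^ 2 * (q ^ (2 * l) : ℝ) := by
    rw [hA, hB]
    have : q ^ (l / 2) * q ^ ((l + 1) / 2) = invRadius q l ^ 2 * q ^ (2 * l) := by
      rw [invRadius, ← Real.rpow_natCast _ 2, ← Real.rpow_mul hq0.le, ← Real.rpow_add hq0,
        ← Real.rpow_add hq0]
      congr 1
      push_cast; ring
    exact_mod_cast this
  rw [eigval_eq hq0]
  clear_value e₁ e₂ A B
  generalize Real.cos θ = ν at hsum ⊢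
  ext n
  rw [map_smul, smul_eq_mul]
  rcases n with _ | n
  · rw [coeff_zero_I1 hq0]
    have h1 := congrArg (PowerSeries.coeff (0 + 1)) key
    simp only [map_sub, map_smul, smul_eq_mul, PowerSeries.coeff_succ_X_mul,
      PowerSeries.coeff_zero_X_mul, PowerSeries.coeff_rescale, pow_zero, mul_zero,
      sub_zero, one_mul] at h1
    simp only [zero_add, pow_one] at h1
    push_cast
    field_simp
    linear_combination (-specScale q : ℂ) * h1 - (specScale q : ℂ) * PowerSeries.coeff 0 F * hsum
      + (specScale q : ℂ) * PowerSeries.coeff 0 F * hAB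
  · rw [coeff_succ_I1 hq0]
    -- Coefficient `n + 2` of the functional equation is row `n + 1` of the eigenvalue equation, up
    -- to a constant factor.
    have h1 := congrArg (PowerSeries.coeff (n + 2)) key
    simp only [map_sub, map_smul, smul_eq_mul, PowerSeries.coeff_succ_X_mul,
      PowerSeries.coeff_rescale] at h1
    push_cast at hABp ⊢
    field_simp
    linear_combination (-specScale q : ℂ) * h1
      - (specScale q : ℂ) * PowerSeries.coeff (n + 1) F * hsum
      + (specScale q : ℂ) * PowerSeries.coeff n F * hprod
      + (specScale q : ℂ) * PowerSeries.coeff (n + 1) F * q ^ (n + 1) * hAB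
      - (specScale q : ℂ) * PowerSeries.coeff n F * q ^ n * hABp

end coeff

/-! ### Realization of `I₁` on the Hilbert space -/

section realize
variable {q l : ℝ} (hq0 : 0 < q) (hq1 : q < 1) (hl : 0 < l)

theorem cCoeff_succ (q l : ℝ) (n : ℕ) :
    cCoeff q l (n + 1) = cCoeff q l n * (√(qNum q (2 * l + n)) / √(qNum q (n + 1))) := by
  rw [cCoeff, Finset.prod_Icc_succ_top (by omega), ← cCoeff]
  congr 4
  · push_cast; ring_nf
  · push_cast; rfl

include hq0 hq1 in
-- The factor `q^{-n/2}/(1-q)` common to `[2l+n]_q` and `[n+1]_q` cancels in the ratio of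
-- consecutive `c_n`.
theorem cCoeff_succ_mul_sqrt (l : ℝ) (n : ℕ) : cCoeff q l (n + 1) * √(1 - q ^ (n + 1))
    = invRadius q l * √(1 - q ^ (2 * l) * q ^ n) * cCoeff q l n := by
  obtain ⟨a1, -⟩ := one_sub_pow_succ_mem hq0 hq1 n
  have h1q : 0 < 1 - q := sub_pos.2 hq1
  set k : ℝ := q ^ (-(n : ℝ) / 2) / (1 - q) with hk
  have hk0 : 0 < k := div_pos (Real.rpow_pos_of_pos hq0 _) h1q
  have e1 : qNum q (2 * l + n) = invRadius q l ^ 2 * (k * (1 - q ^ (2 * l) * q ^ n)) := by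
    rw [qNum_two_mul_add hq0, hk]; ring
  have e2 : qNum q (n + 1) = k * (1 - q ^ (n + 1)) := by rw [qNum_nat hq0, hk]; ring
  rw [cCoeff_succ, e1, e2, Real.sqrt_mul (sq_nonneg _), Real.sqrt_sq (invRadius_pos hq0 l).le,
    Real.sqrt_mul hk0.le, Real.sqrt_mul hk0.le]
  have := Real.sqrt_pos.2 hk0
  have := Real.sqrt_pos.2 a1
  field_simp

include hq0 in
theorem rpow_two_mul_pos (l : ℝ) : 0 < q ^ (2 * l) := Real.rpow_pos_of_pos hq0 _

include hq0 hq1 hl in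
theorem rpow_two_mul_lt_one : q ^ (2 * l) < 1 := Real.rpow_lt_one hq0.le hq1 (by linarith)

include hq0 hq1 hl in
theorem cCoeff_pos (n : ℕ) : 0 < cCoeff q l n := by
  induction n with
  | zero => simp [cCoeff]
  | succ n ih =>
    have h := cCoeff_succ_mul_sqrt hq0 hq1 l n
    obtain ⟨a1, -⟩ := one_sub_pow_succ_mem hq0 hq1 n
    obtain ⟨b1, -⟩ := one_sub_mul_pow_mem hq0 hq1 (rpow_two_mul_pos hq0 l)
      (rpow_two_mul_lt_one hq0 hq1 hl) n
    have h1 := Real.sqrt_pos.2 a1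
    have h2 := Real.sqrt_pos.2 b1
    have h3 := invRadius_pos hq0 l
    have : 0 < cCoeff q l (n + 1) * √(1 - q ^ (n + 1)) := by rw [h]; positivity
    exact pos_of_mul_pos_left this h1.le

include hq0 hq1 hl in
theorem toSeries_injective : Function.Injective (toSeries q l) := by
  intro u v h
  ext n
  have := congrArg (PowerSeries.coeff n) h
  have hc : (cCoeff q l n : ℂ) ≠ 0 := by exact_mod_cast (cCoeff_pos hq0 hq1 hl n).ne'
  simpa [toSeries, hc] using this

theorem toSeries_smul (q l : ℝ) (c : ℂ) (u : H) : toSeries q l (c • u) = c • toSeries q l u := by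
  ext n; simp [toSeries, mul_assoc]

theorem toSeries_zero (q l : ℝ) : toSeries q l 0 = 0 := by
  ext n; simp [toSeries]

include hq0 hq1 in
-- With the next lemma: rescaling by `c_n` symmetrizes the matrix, and the raising and lowering
-- entries both become their geometric mean.
theorem ascOff_mul_cCoeff (l : ℝ) (n : ℕ) : ascOff q (q ^ (2 * l)) n * cCoeff q l n
    = (invRadius q l)⁻¹ * (1 - q ^ (n + 1)) / 2 * cCoeff q l (n + 1) := by
  have h := cCoeff_succ_mul_sqrt hq0 hq1 l n
  obtain ⟨a1, -⟩ := one_sub_pow_succ_mem hq0 hq1 n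
  have e1 := Real.mul_self_sqrt a1.le
  have hs := inv_mul_cancel₀ (invRadius_pos hq0 l).ne'
  rw [ascOff, Real.sqrt_mul a1.le]
  linear_combination (-((invRadius q l)⁻¹ * √(1 - q ^ (n + 1)) / 2)) * h
    - √(1 - q ^ (n + 1)) * √(1 - q ^ (2 * l) * q ^ n) * cCoeff q l n / 2 * hs
    + (invRadius q l)⁻¹ * cCoeff q l (n + 1) / 2 * e1

include hq0 hq1 hl in
theorem ascOff_mul_cCoeff_succ (n : ℕ) : ascOff q (q ^ (2 * l)) n * cCoeff q l (n + 1)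
    = invRadius q l * (1 - q ^ (2 * l) * q ^ n) / 2 * cCoeff q l n := by
  have h := cCoeff_succ_mul_sqrt hq0 hq1 l n
  obtain ⟨a1, -⟩ := one_sub_pow_succ_mem hq0 hq1 n
  obtain ⟨b1, -⟩ := one_sub_mul_pow_mem hq0 hq1 (rpow_two_mul_pos hq0 l)
    (rpow_two_mul_lt_one hq0 hq1 hl) n
  have e1 := Real.mul_self_sqrt b1.le
  rw [ascOff, Real.sqrt_mul a1.le]
  linear_combination (√(1 - q ^ (2 * l) * q ^ n) / 2) * h
    + invRadius q l * cCoeff q l n / 2 * e1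

/-- The normalized Jacobi operator `X` with `I₁ = β (1 - X)`. -/
def normOp (hq0 : 0 < q) (hq1 : q < 1) (hl : 0 < l) : H →L[ℂ] H :=
  ascOp (halfSum q l) hq0 hq1 (rpow_two_mul_pos hq0 l) (rpow_two_mul_lt_one hq0 hq1 hl)

/-- The bounded operator on `H_l` given by `I₁`. -/
def hilbertI1 (hq0 : 0 < q) (hq1 : q < 1) (hl : 0 < l) : H →L[ℂ] H :=
  (specScale q : ℂ) • (1 - normOp hq0 hq1 hl)

theorem hilbertI1_apply (u : H) (n : ℕ) :
    hilbertI1 hq0 hq1 hl u n = specScale q * (u n - normOp hq0 hq1 hl u n) := rfl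

theorem realizes_hilbertI1 : Realizes q l (hilbertI1 hq0 hq1 hl) (I1 q l) := by
  intro u
  ext n
  rcases n with _ | n
  · rw [coeff_zero_I1 hq0]
    have h1 := congrArg (fun t : ℝ => (t : ℂ)) (ascOff_mul_cCoeff hq0 hq1 l 0)
    simp only [toSeries, PowerSeries.coeff_mk, hilbertI1_apply, normOp, ascOp_apply_zero]
    push_cast at h1 ⊢
    simp only [pow_one] at h1
    linear_combination (-specScale q * u 1 : ℂ) * h1
  · rw [coeff_succ_I1 hq0]
    have h1 := congrArg (fun t : ℝ => (t : ℂ)) (ascOff_mul_cCoeff hq0 hq1 l (n + 1))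
    have h2 := congrArg (fun t : ℝ => (t : ℂ)) (ascOff_mul_cCoeff_succ hq0 hq1 hl n)
    simp only [toSeries, PowerSeries.coeff_mk, hilbertI1_apply, normOp, ascOp_apply_succ]
    push_cast at h1 h2 ⊢
    linear_combination (-specScale q * u (n + 2) : ℂ) * h1 - (specScale q * u n : ℂ) * h2

theorem isSelfAdjoint_hilbertI1 : IsSelfAdjoint (hilbertI1 hq0 hq1 hl) := by
  have h : IsSelfAdjoint (normOp hq0 hq1 hl) := isSelfAdjoint_ascOp _ _ _ _
  rw [IsSelfAdjoint, hilbertI1, star_smul, star_sub, h, star_one]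
  simp

/-! ### The spectrum of `I₁` -/

theorem hasEigenvalue_iff {T : H →L[ℂ] H} {z : ℂ} :
    Module.End.HasEigenvalue (T : H →ₗ[ℂ] H) z ↔ ∃ u : H, u ≠ 0 ∧ T u = z • u := by
  constructor
  · intro h
    obtain ⟨u, hu⟩ := h.exists_hasEigenvector
    exact ⟨u, hu.2, hu.apply_eq_smul⟩
  · rintro ⟨u, hu, h⟩
    exact Module.End.hasEigenvalue_of_hasEigenvector (x := u)
      ⟨Module.End.mem_eigenspace_iff.2 h, hu⟩

include hq0 hq1 in
theorem specScale_ne_zero : (specScale q : ℂ) ≠ 0 := by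
  exact_mod_cast (specScale_pos hq0 hq1).ne'

theorem hilbertI1_eq_smul_iff {u : H} {w : ℂ} :
    hilbertI1 hq0 hq1 hl u = (specScale q * (1 - w)) • u ↔ normOp hq0 hq1 hl u = w • u := by
  have e : hilbertI1 hq0 hq1 hl u - (specScale q * (1 - w)) • u
      = (-specScale q : ℂ) • (normOp hq0 hq1 hl u - w • u) := by
    have : hilbertI1 hq0 hq1 hl u = (specScale q : ℂ) • (u - normOp hq0 hq1 hl u) := rfl
    rw [this]; module
  rw [← sub_eq_zero, e, smul_eq_zero_iff_right (neg_ne_zero.2 (specScale_ne_zero hq0 hq1)),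
    sub_eq_zero]

theorem hasEigenvalue_hilbertI1_iff {w : ℂ} :
    Module.End.HasEigenvalue (hilbertI1 hq0 hq1 hl : H →ₗ[ℂ] H) (specScale q * (1 - w)) ↔
      Module.End.HasEigenvalue (normOp hq0 hq1 hl : H →ₗ[ℂ] H) w := by
  simp only [hasEigenvalue_iff, hilbertI1_eq_smul_iff]

theorem mem_spectrum_hilbertI1_iff {w : ℂ} :
    (specScale q * (1 - w) : ℂ) ∈ spectrum ℂ (hilbertI1 hq0 hq1 hl) ↔
      w ∈ spectrum ℂ (normOp hq0 hq1 hl) := by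
  have hb := specScale_ne_zero hq0 hq1
  have e : algebraMap ℂ (H →L[ℂ] H) (specScale q * (1 - w)) - hilbertI1 hq0 hq1 hl
      = Units.mk0 (-specScale q : ℂ) (neg_ne_zero.2 hb) •
        (algebraMap ℂ (H →L[ℂ] H) w - normOp hq0 hq1 hl) := by
    rw [Units.smul_mk0, hilbertI1, Algebra.algebraMap_eq_smul_one, Algebra.algebraMap_eq_smul_one]
    module
  rw [spectrum.mem_iff, spectrum.mem_iff, e, isUnit_smul_iff]

include hq0 hq1 in
theorem exists_eq_specScale_mul (z : ℂ) : ∃ w : ℂ, z = specScale q * (1 - w) := by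
  refine ⟨1 - z / specScale q, ?_⟩
  have := specScale_ne_zero hq0 hq1
  field_simp
  ring

include hq0 hq1 in
theorem specScale_mul_mem_iff (w : ℂ) :
    (specScale q * (1 - w) : ℂ) ∈
        (fun t : ℝ => (t : ℂ)) '' Set.Icc 0 (2 * q ^ (1 / 2 : ℝ) / (1 - q)) ↔
      ∃ x : ℝ, x ∈ Set.Icc (-1) 1 ∧ w = x := by
  have hb := specScale_pos hq0 hq1
  have e : 2 * q ^ (1 / 2 : ℝ) / (1 - q) = 2 * specScale q := by rw [specScale]; ring
  rw [e]
  constructor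
  · rintro ⟨t, ⟨h0, h1⟩, ht⟩
    have hb' := specScale_ne_zero hq0 hq1
    refine ⟨1 - t / specScale q, ⟨?_, ?_⟩, ?_⟩
    · have : t / specScale q ≤ 2 := (div_le_iff₀ hb).2 h1
      linarith
    · have : 0 ≤ t / specScale q := by positivity
      linarith
    · push_cast
      rw [show (t : ℂ) = specScale q * (1 - w) from ht]
      field_simp
      ring
  · rintro ⟨x, ⟨h0, h1⟩, rfl⟩
    exact ⟨specScale q * (1 - x), ⟨by nlinarith, by nlinarith⟩, by push_cast; rfl⟩

theorem continuousSpectrum_hilbertI1 : continuousSpectrum (hilbertI1 hq0 hq1 hl) =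
    (fun t : ℝ => (t : ℂ)) '' Set.Icc 0 (2 * q ^ (1 / 2 : ℝ) / (1 - q)) := by
  ext z
  obtain ⟨w, rfl⟩ := exists_eq_specScale_mul hq0 hq1 z
  rw [specScale_mul_mem_iff hq0 hq1]
  simp only [continuousSpectrum, Set.mem_ofPred_eq, mem_spectrum_hilbertI1_iff,
    hasEigenvalue_hilbertI1_iff]
  constructor
  · rintro ⟨h1, h2⟩
    by_contra h3
    exact h2 (hasEigenvalue_ascOp_of_mem_spectrum _ _ _ _ h1 h3)
  · rintro ⟨x, hx, rfl⟩
    exact ⟨mem_spectrum_ascOp _ _ _ _ hx, not_hasEigenvalue_ascOp _ _ _ _ hx⟩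

include hq0 hq1 in
-- This is `(1 - A)(1 - B) ≥ 0` for `A = q^{l+1/4}` and `B = q^{l-1/4}`. The bound `l ≥ 1/4` serves
-- to give `B ≤ 1`.
theorem two_mul_halfSum_le (hl4 : 1 / 4 ≤ l) : 2 * halfSum q l ≤ 1 + q ^ (2 * l) := by
  have hA : q ^ (l + 1 / 4) ≤ 1 := Real.rpow_le_one hq0.le hq1.le (by linarith)
  have hB : q ^ (l - 1 / 4) ≤ 1 := Real.rpow_le_one hq0.le hq1.le (by linarith)
  have e1 : 2 * halfSum q l = q ^ (l + 1 / 4) + q ^ (l - 1 / 4) := by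
    rw [halfSum, Real.rpow_add hq0, sub_eq_add_neg, Real.rpow_add hq0]; ring
  have e2 : q ^ (2 * l) = q ^ (l + 1 / 4) * q ^ (l - 1 / 4) := by
    rw [← Real.rpow_add hq0]; congr 1; ring
  rw [e1, e2]
  nlinarith

theorem spectrum_hilbertI1 (hl4 : 1 / 4 ≤ l) : spectrum ℂ (hilbertI1 hq0 hq1 hl) =
    (fun t : ℝ => (t : ℂ)) '' Set.Icc 0 (2 * q ^ (1 / 2 : ℝ) / (1 - q)) := by
  ext z
  obtain ⟨w, rfl⟩ := exists_eq_specScale_mul hq0 hq1 z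
  rw [specScale_mul_mem_iff hq0 hq1, mem_spectrum_hilbertI1_iff]
  constructor
  · intro h
    by_contra h3
    obtain ⟨u, hu, h4⟩ := hasEigenvalue_iff.1 (hasEigenvalue_ascOp_of_mem_spectrum _ _ _ _ h h3)
    have h5 := norm_le_one_of_ascOp_eq_smul _ _ _ _ (halfSum_pos hq0 l).le
      (two_mul_halfSum_le hq0 hq1 hl4) hu h4
    have h6 : w = w.re := (isSelfAdjoint_ascOp _ _ _ _).mem_spectrum_eq_re h
    exact h3 ⟨w.re, abs_le.1 ((Complex.abs_re_le_norm w).trans h5), h6⟩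
  · rintro ⟨x, hx, rfl⟩
    exact mem_spectrum_ascOp _ _ _ _ hx

end realize

/-! ### Generalized eigenfunctions -/

section eigen
variable {q l : ℝ} (hq0 : 0 < q) (hq1 : q < 1) (hl : 0 < l)
include hq0 hq1 hl

theorem isGeneralizedEigenfunction_xi (θ : ℝ) :
    IsGeneralizedEigenfunction q l (I1 q l) (eigval q (Real.cos θ) : ℂ) (xi q l θ) := by
  obtain ⟨F, hF0, hF, hI⟩ := exists_expansion_xi hq0 hq1 l θ
  have hne : F ≠ 0 := by rintro rfl; simp at hF0
  refine ⟨F, hne, hF, hI, fun G hG => ⟨PowerSeries.coeff 0 G, ?_⟩, fun u hu => hne ?_⟩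
  · rw [← sub_eq_zero]
    refine eq_zero_of_I1_eq_smul hq0 hq1 (l := l) (μ := eigval q (Real.cos θ)) ?_ ?_
    · rw [map_sub, map_smul, hG, hI, smul_sub, smul_comm]
    · rw [map_sub, map_smul, hF0, smul_eq_mul, mul_one, sub_self]
  -- If the series came from some `u` in `H_l`, then `u` would be an eigenvector of `X` at `cos θ ∈
  -- [-1, 1]`.
  · have h1 : hilbertI1 hq0 hq1 hl u = (eigval q (Real.cos θ) : ℂ) • u := by
      refine toSeries_injective hq0 hq1 hl ?_
      rw [realizes_hilbertI1, toSeries_smul, hu, hI]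
    rw [eigval_eq hq0] at h1
    push_cast at h1
    rw [hilbertI1_eq_smul_iff] at h1
    rw [← Complex.ofReal_cos] at h1
    have h2 := eq_zero_of_ascOp_eq_smul _ _ _ _ (Real.cos_mem_Icc θ) h1
    rw [← hu, h2, toSeries_zero]

end eigen

/-! ### Rotation by `φ` -/

/-- The unitary operator `f(x) ↦ f(e^{iφ} x)` on `H_l`. -/
def rotOp (φ : ℝ) : H →L[ℂ] H :=
  diagOp (fun n => Complex.exp (Complex.I * φ) ^ n) (C := 1) fun n => by
    rw [norm_pow, norm_exp_I_mul, one_pow]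

theorem rotOp_apply (φ : ℝ) (u : H) (n : ℕ) :
    rotOp φ u n = Complex.exp (Complex.I * φ) ^ n * u n := rfl

theorem exp_I_mul_mul_exp_I_mul_neg (φ : ℝ) :
    Complex.exp (Complex.I * φ) * Complex.exp (Complex.I * (-φ : ℝ)) = 1 := by
  rw [← Complex.exp_add]; simp

theorem rotOp_mul_rotOp_neg (φ : ℝ) : rotOp φ * rotOp (-φ) = 1 := by
  ext u n
  rw [mul_apply_eq_comp, rotOp_apply, rotOp_apply, ← mul_assoc, ← mul_pow,
    exp_I_mul_mul_exp_I_mul_neg, one_pow, one_mul]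
  rfl

theorem rotOp_neg_mul_rotOp (φ : ℝ) : rotOp (-φ) * rotOp φ = 1 := by
  simpa using rotOp_mul_rotOp_neg (-φ)

/-- The rotation as an invertible operator. -/
def rotUnit (φ : ℝ) : (H →L[ℂ] H)ˣ :=
  ⟨rotOp φ, rotOp (-φ), rotOp_mul_rotOp_neg φ, rotOp_neg_mul_rotOp φ⟩

theorem star_rotOp (φ : ℝ) : star (rotOp φ) = rotOp (-φ) := by
  rw [rotOp, star_diagOp]
  ext u n
  rw [diagOp_apply, rotOp_apply, map_pow, ← Complex.exp_conj]
  simp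

theorem toSeries_rotOp (q l φ : ℝ) (u : H) : toSeries q l (rotOp φ u)
    = PowerSeries.rescale (Complex.exp (Complex.I * φ)) (toSeries q l u) := by
  ext n
  simp [toSeries, rotOp_apply, mul_assoc]

theorem rescale_exp_neg_rescale_exp (φ : ℝ) (f : PowerSeries ℂ) :
    PowerSeries.rescale (Complex.exp (Complex.I * (-φ : ℝ)))
      (PowerSeries.rescale (Complex.exp (Complex.I * φ)) f) = f := by
  rw [PowerSeries.rescale_rescale, exp_I_mul_mul_exp_I_mul_neg, PowerSeries.rescale_one]
  rfl

theorem rescale_exp_rescale_exp_neg (φ : ℝ) (f : PowerSeries ℂ) :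
    PowerSeries.rescale (Complex.exp (Complex.I * φ))
      (PowerSeries.rescale (Complex.exp (Complex.I * (-φ : ℝ))) f) = f := by
  simpa using rescale_exp_neg_rescale_exp (-φ) f

theorem rescale_smul (a c : ℂ) (f : PowerSeries ℂ) :
    PowerSeries.rescale a (c • f) = c • PowerSeries.rescale a f := by
  ext n
  simp [mul_left_comm]

/-- `I₁^{(φ)}` is conjugate to `I₁` by the rotation `f(x) ↦ f(e^{iφ} x)`. -/
theorem I1rot_rescale (q l φ : ℝ) (f : PowerSeries ℂ) :
    I1rot q l φ (PowerSeries.rescale (Complex.exp (Complex.I * φ)) f)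
      = PowerSeries.rescale (Complex.exp (Complex.I * φ)) (I1 q l f) := by
  -- The identity behind the computation is `cos φ J₁ - sin φ J₂ = ½ (e^{iφ} J₊ + e^{-iφ} J₋)`:
  -- these phases are what the rescaling by `e^{iφ}` produces when the degree changes by `±1`.
  have hcs : Complex.exp (Complex.I * φ) = Real.cos φ + Real.sin φ * Complex.I := by
    rw [mul_comm, Complex.exp_mul_I]; push_cast; ring
  have hone : (Real.cos φ : ℂ) ^ 2 + (Real.sin φ : ℂ) ^ 2 = 1 := by
    exact_mod_cast Real.cos_sq_add_sin_sq φ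
  have hI := Complex.I_sq
  have h2I : (1 / (2 * Complex.I) : ℂ) = -Complex.I / 2 := by
    have := Complex.I_ne_zero
    field_simp
    linear_combination hI
  have hinv : Complex.exp (Complex.I * φ) * (Real.cos φ - Real.sin φ * Complex.I) = 1 := by
    rw [hcs]
    linear_combination hone - (Real.sin φ : ℂ) ^ 2 * hI
  generalize Complex.exp (Complex.I * φ) = e at hcs hinv ⊢
  ext n
  rcases n with _ | n <;>
  simp only [I1, I1rot, qPowJ0, J1, J2, Jplus, Jminus, mulX, divX, funJ0, LinearMap.sub_apply,
    LinearMap.smul_apply, LinearMap.comp_apply, LinearMap.add_apply, LinearMap.coe_mk,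
    AddHom.coe_mk, LinearMap.mulLeft_apply, map_sub, map_add, map_smul, PowerSeries.coeff_mk,
    PowerSeries.coeff_succ_X_mul, PowerSeries.coeff_zero_X_mul, PowerSeries.coeff_rescale,
    smul_eq_mul, LinearMap.id_apply, h2I]
  · linear_combination (-((q ^ (1 / 4 * (l + (0 : ℕ))) : ℝ) * ((qNum q (l + (0 + 1 : ℕ) - l) : ℝ) *
      ((q ^ (1 / 4 * (l + (0 + 1 : ℕ))) : ℝ) * PowerSeries.coeff (0 + 1) f)) / 2) : ℂ) * hinv
  · linear_combination (-(e ^ (n + 1) * (q ^ (1 / 4 * (l + (n + 1 : ℕ))) : ℝ) *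
      ((qNum q (l + (n + 1 + 1 : ℕ) - l) : ℝ) * ((q ^ (1 / 4 * (l + (n + 1 + 1 : ℕ))) : ℝ) *
        PowerSeries.coeff (n + 1 + 1) f)) / 2) : ℂ) * hinv
      + ((q ^ (1 / 4 * (l + (n + 1 : ℕ))) : ℝ) * ((qNum q (l + n + l) : ℝ) *
        ((q ^ (1 / 4 * (l + n)) : ℝ) * (e ^ n * PowerSeries.coeff n f))) / 2 : ℂ) * hcs

theorem IsGeneralizedEigenfunction.rotate {q l : ℝ} {μ : ℂ} {f : ℂ → ℂ}
    (h : IsGeneralizedEigenfunction q l (I1 q l) μ f) (φ : ℝ) :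
    IsGeneralizedEigenfunction q l (I1rot q l φ) μ
      (fun x => f (Complex.exp (Complex.I * φ) * x)) := by
  obtain ⟨F, hne, hF, hI, huniq, hnot⟩ := h
  refine ⟨PowerSeries.rescale (Complex.exp (Complex.I * φ)) F, fun h0 => hne ?_,
    hF.comp_mul (norm_exp_I_mul φ).le, ?_, fun G hG => ?_, fun u hu => ?_⟩
  · rw [← rescale_exp_neg_rescale_exp φ F, h0, map_zero]
  · rw [I1rot_rescale, hI, rescale_smul]
  · obtain ⟨c, hc⟩ := huniq (PowerSeries.rescale (Complex.exp (Complex.I * (-φ : ℝ))) G) (by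
      rw [← rescale_exp_neg_rescale_exp φ (I1 q l _), ← I1rot_rescale,
        rescale_exp_rescale_exp_neg, hG, rescale_smul])
    refine ⟨c, ?_⟩
    rw [← rescale_exp_rescale_exp_neg φ G, hc, rescale_smul]
  · refine hnot (rotOp (-φ) u) ?_
    rw [toSeries_rotOp, hu, rescale_exp_neg_rescale_exp]

theorem realizes_rotate {q l : ℝ} {T : H →L[ℂ] H} (h : Realizes q l T (I1 q l)) (φ : ℝ) :
    Realizes q l (rotOp φ * T * rotOp (-φ)) (I1rot q l φ) := by
  intro u
  rw [mul_apply_eq_comp, mul_apply_eq_comp, toSeries_rotOp, h, ← I1rot_rescale, toSeries_rotOp,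
    rescale_exp_rescale_exp_neg]

theorem isSelfAdjoint_rotate {T : H →L[ℂ] H} (h : IsSelfAdjoint T) (φ : ℝ) :
    IsSelfAdjoint (rotOp φ * T * rotOp (-φ)) := by
  rw [← star_rotOp]
  exact h.conjugate _

theorem spectrum_rotate (T : H →L[ℂ] H) (φ : ℝ) :
    spectrum ℂ (rotOp φ * T * rotOp (-φ)) = spectrum ℂ T :=
  spectrum.units_conjugate (u := rotUnit φ)

theorem hasEigenvalue_rotate_iff {T : H →L[ℂ] H} {z : ℂ} (φ : ℝ) :
    Module.End.HasEigenvalue ((rotOp φ * T * rotOp (-φ) : H →L[ℂ] H) : H →ₗ[ℂ] H) z ↔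
      Module.End.HasEigenvalue (T : H →ₗ[ℂ] H) z := by
  have key : ∀ (S : H →L[ℂ] H) (ψ : ℝ) (u : H), u ≠ 0 → S u = z • u →
      rotOp ψ u ≠ 0 ∧ (rotOp ψ * S * rotOp (-ψ)) (rotOp ψ u) = z • rotOp ψ u := by
    intro S ψ u hu h
    have e : rotOp (-ψ) (rotOp ψ u) = u := by
      rw [← mul_apply_eq_comp, rotOp_neg_mul_rotOp, one_apply_eq_self]
    refine ⟨fun h0 => hu ?_, ?_⟩
    · rw [← e, h0, map_zero]
    · rw [mul_apply_eq_comp, mul_apply_eq_comp, e, h, map_smul]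
  rw [hasEigenvalue_iff, hasEigenvalue_iff]
  constructor
  · rintro ⟨u, hu, h⟩
    have e : rotOp (-φ) * (rotOp φ * T * rotOp (-φ)) * rotOp (- -φ) = T := by
      rw [neg_neg, mul_assoc, mul_assoc, mul_assoc, rotOp_neg_mul_rotOp, mul_one, ← mul_assoc,
        rotOp_neg_mul_rotOp, one_mul]
    have h1 := key _ (-φ) u hu h
    rw [e] at h1
    exact ⟨_, h1⟩
  · rintro ⟨u, hu, h⟩
    exact ⟨_, key _ φ u hu h⟩

theorem continuousSpectrum_rotate (T : H →L[ℂ] H) (φ : ℝ) :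
    continuousSpectrum (rotOp φ * T * rotOp (-φ)) = continuousSpectrum T := by
  simp only [continuousSpectrum, spectrum_rotate, hasEigenvalue_rotate_iff]

/-! ### Cyclic vectors -/

/-- An operator given by a Hessenberg matrix with nonzero subdiagonal has a cyclic vector. -/
theorem hasSimpleSpectrum_of_hessenberg {T : H →L[ℂ] H}
    (h0 : ∀ k j, k + 1 < j → T (lp.single 2 k (1 : ℂ)) j = 0)
    (h1 : ∀ k, T (lp.single 2 k (1 : ℂ)) (k + 1) ≠ 0) : HasSimpleSpectrum T := by
  refine ⟨lp.single 2 0 (1 : ℂ), ?_⟩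
  set S := Submodule.span ℂ (Set.range fun n : ℕ => (T ^ n) (lp.single 2 0 (1 : ℂ))) with hS
  have inv : ∀ u ∈ S, T u ∈ S := by
    intro u hu
    induction hu using Submodule.span_induction with
    | mem x hx =>
      obtain ⟨n, rfl⟩ := hx
      refine Submodule.subset_span ⟨n + 1, ?_⟩
      simp only [pow_succ', mul_apply_eq_comp]
    | zero => rw [map_zero]; exact S.zero_mem
    | add x y _ _ hx hy => rw [map_add]; exact S.add_mem hx hy
    | smul c x _ hx => rw [map_smul]; exact S.smul_mem c hx
  have sing : ∀ (n : ℕ) (c : ℂ), lp.single 2 n c = c • (lp.single 2 n (1 : ℂ) : H) := by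
    intro n c
    rw [← lp.single_smul, smul_eq_mul, mul_one]
  -- `T e_n` is a combination of `e_0, …, e_n` plus a nonzero multiple of `e_{n+1}`, so the
  -- invariant subspace `S` contains every `e_{n+1}` in turn.
  have basis : ∀ n, ∀ k ≤ n, (lp.single 2 k (1 : ℂ) : H) ∈ S := by
    intro n
    induction n with
    | zero =>
      intro k hk
      obtain rfl : k = 0 := by omega
      exact Submodule.subset_span ⟨0, by simp⟩
    | succ n ih =>
      intro k hk
      rcases Nat.lt_or_ge k (n + 1) with hlt | hge
      · exact ih k (by omega)
      obtain rfl : k = n + 1 := by omega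
      set v : H := T (lp.single 2 n (1 : ℂ)) with hv
      have e : v = ∑ j ∈ Finset.range (n + 1), lp.single 2 j (v j) + lp.single 2 (n + 1) (v (n + 1))
          := by
        rw [← Finset.sum_range_succ (fun j => (lp.single 2 j (v j) : H))]
        ext m
        rw [lp.coeFn_sum, Finset.sum_apply]
        simp only [lp.single_apply, Pi.single_apply, Finset.sum_ite_eq, Finset.mem_range]
        split_ifs with hm
        · rfl
        · exact h0 n m (by omega)
      have h2 : (lp.single 2 (n + 1) (1 : ℂ) : H)
          = (v (n + 1))⁻¹ • (v - ∑ j ∈ Finset.range (n + 1), lp.single 2 j (v j)) := by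
        rw [eq_inv_smul_iff₀ (h1 n), ← sing]
        exact eq_sub_of_add_eq' e.symm
      rw [h2]
      refine S.smul_mem _ (S.sub_mem (inv _ (ih n le_rfl)) (S.sum_mem fun j hj => ?_))
      rw [sing]
      exact S.smul_mem _ (ih j (by have := Finset.mem_range.1 hj; omega))
  rw [Submodule.eq_top_iff']
  intro u
  have hsum := lp.hasSum_single (p := 2) (by norm_num) u
  refine S.isClosed_topologicalClosure.mem_of_tendsto hsum (.of_forall fun s => ?_)
  refine S.le_topologicalClosure (S.sum_mem fun j _ => ?_)
  rw [sing]
  exact S.smul_mem _ (basis j j le_rfl)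

/-- Conjugation by the rotation multiplies the matrix entries by unimodular phases, so the matrix
stays tridiagonal with nonzero subdiagonal. -/
theorem hasSimpleSpectrum_rotate_hilbertI1 {q l : ℝ} (hq0 : 0 < q) (hq1 : q < 1) (hl : 0 < l)
    (φ : ℝ) : HasSimpleSpectrum (rotOp φ * hilbertI1 hq0 hq1 hl * rotOp (-φ)) := by
  have hr : ∀ k, rotOp (-φ) (lp.single 2 k (1 : ℂ))
      = Complex.exp (Complex.I * (-φ : ℝ)) ^ k • (lp.single 2 k (1 : ℂ) : H) := by
    intro k
    ext n
    simp only [rotOp_apply, lp.coeFn_smul, Pi.smul_apply, smul_eq_mul, lp.single_apply,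
      Pi.single_apply]
    split_ifs with h
    · rw [h]
    · simp
  have hT : ∀ k j, (rotOp φ * hilbertI1 hq0 hq1 hl * rotOp (-φ)) (lp.single 2 k (1 : ℂ)) (j + 1)
      = Complex.exp (Complex.I * φ) ^ (j + 1) * (Complex.exp (Complex.I * (-φ : ℝ)) ^ k *
        hilbertI1 hq0 hq1 hl (lp.single 2 k (1 : ℂ)) (j + 1)) := by
    intro k j
    rw [mul_apply_eq_comp, mul_apply_eq_comp, hr, map_smul, rotOp_apply]
    rfl
  refine hasSimpleSpectrum_of_hessenberg (fun k j hkj => ?_) fun k => ?_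
  · obtain ⟨j, rfl⟩ : ∃ i, j = i + 1 := ⟨j - 1, by omega⟩
    rw [hT, hilbertI1_apply, normOp, ascOp_apply_succ]
    simp only [lp.single_apply, Pi.single_apply]
    rw [if_neg (by omega), if_neg (by omega), if_neg (by omega)]
    simp
  · rw [hT, hilbertI1_apply, normOp, ascOp_apply_succ]
    simp only [lp.single_apply, Pi.single_apply]
    rw [if_neg (by omega), if_neg (by omega), if_pos trivial]
    have h1 := specScale_ne_zero hq0 hq1
    have h2 : (ascOff q (q ^ (2 * l)) k : ℂ) ≠ 0 := by
      exact_mod_cast (ascOff_pos hq0 hq1 (rpow_two_mul_pos hq0 l)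
        (rpow_two_mul_lt_one hq0 hq1 hl) k).ne'
    simp [h1, h2, Complex.exp_ne_zero]

/-! ### The range of the eigenvalues and the assembly of the theorem -/

theorem image_eigval {q : ℝ} (hq0 : 0 < q) (hq1 : q < 1) :
    eigval q '' Set.Icc (-1) 1 = Set.Icc 0 (2 * q ^ (1 / 2 : ℝ) / (1 - q)) := by
  have hb := specScale_pos hq0 hq1
  have e : 2 * q ^ (1 / 2 : ℝ) / (1 - q) = 2 * specScale q := by rw [specScale]; ring
  rw [e]
  ext t
  constructor
  · rintro ⟨ν, ⟨h0, h1⟩, rfl⟩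
    rw [eigval_eq hq0]
    exact ⟨by nlinarith, by nlinarith⟩
  · rintro ⟨h0, h1⟩
    refine ⟨1 - t / specScale q, ⟨?_, ?_⟩, ?_⟩
    · have : t / specScale q ≤ 2 := (div_le_iff₀ hb).2 h1
      linarith
    · have : 0 ≤ t / specScale q := by positivity
      linarith
    · rw [eigval_eq hq0]
      field_simp
      ring

end QSu11

end

theorem theorem2 (q l φ : ℝ) (hq0 : 0 < q) (hq1 : q < 1) (hl : 0 < l) :
    -- the explicit form of the function `ξ_λ^l(e^{iφ} x; q)`
    (∀ (θ : ℝ) (x : ℂ), QSu11.xi q l θ (Complex.exp (Complex.I * φ) * x) =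
      QSu11.qPochInf ((q ^ (l / 2) : ℝ) * Complex.exp (Complex.I * φ) * x) q *
        QSu11.qPochInf ((q ^ ((l + 1) / 2) : ℝ) * Complex.exp (Complex.I * φ) * x) q /
      (QSu11.qPochInf ((q ^ ((1 - 2 * l) / 4) : ℝ) *
          Complex.exp (Complex.I * (θ + φ)) * x) q *
        QSu11.qPochInf ((q ^ ((1 - 2 * l) / 4) : ℝ) *
          Complex.exp (-(Complex.I * (θ - φ))) * x) q)) ∧
    -- it is an eigenfunction of `I₁^{(φ)}(x)`, with the same eigenvalue as `ξ_λ^l(x; q)` for `I₁(x)`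
    (∀ θ : ℝ,
      QSu11.IsGeneralizedEigenfunction q l (QSu11.I1rot q l φ)
        (QSu11.eigval q (Real.cos θ) : ℂ)
        (fun x => QSu11.xi q l θ (Complex.exp (Complex.I * φ) * x)) ∧
      QSu11.IsGeneralizedEigenfunction q l (QSu11.I1 q l)
        (QSu11.eigval q (Real.cos θ) : ℂ) (QSu11.xi q l θ)) ∧
    -- the range of these eigenvalues
    QSu11.eigval q '' Set.Icc (-1) 1 = Set.Icc 0 (2 * q ^ (1 / 2 : ℝ) / (1 - q)) ∧
    -- both operators are bounded and selfadjoint on `H_l`; their spectra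
    ∃ T₀ T : QSu11.H →L[ℂ] QSu11.H,
      QSu11.Realizes q l T₀ (QSu11.I1 q l) ∧ QSu11.Realizes q l T (QSu11.I1rot q l φ) ∧
      IsSelfAdjoint T₀ ∧ IsSelfAdjoint T ∧
      QSu11.HasSimpleSpectrum T ∧
      QSu11.continuousSpectrum T =
        (fun t : ℝ => (t : ℂ)) '' Set.Icc 0 (2 * q ^ (1 / 2 : ℝ) / (1 - q)) ∧
      (1 / 4 ≤ l → spectrum ℂ T =
        (fun t : ℝ => (t : ℂ)) '' Set.Icc 0 (2 * q ^ (1 / 2 : ℝ) / (1 - q))) ∧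
      spectrum ℂ T = spectrum ℂ T₀ ∧
      QSu11.continuousSpectrum T = QSu11.continuousSpectrum T₀ := by
  -- As `toSeries` is injective, `Realizes` determines the bounded operator, so these witnesses are
  -- the only possible ones.
  refine ⟨fun θ x => ?_, fun θ => ?_, QSu11.image_eigval hq0 hq1, QSu11.hilbertI1 hq0 hq1 hl,
    QSu11.rotOp φ * QSu11.hilbertI1 hq0 hq1 hl * QSu11.rotOp (-φ),
    QSu11.realizes_hilbertI1 hq0 hq1 hl, QSu11.realizes_rotate (QSu11.realizes_hilbertI1 _ _ _) φ,
    QSu11.isSelfAdjoint_hilbertI1 _ _ _, QSu11.isSelfAdjoint_rotate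
      (QSu11.isSelfAdjoint_hilbertI1 _ _ _) φ,
    QSu11.hasSimpleSpectrum_rotate_hilbertI1 hq0 hq1 hl φ, ?_, fun hl4 => ?_,
    QSu11.spectrum_rotate _ φ, QSu11.continuousSpectrum_rotate _ φ⟩
  · have e1 : Complex.exp (Complex.I * (θ + φ))
        = Complex.exp (Complex.I * θ) * Complex.exp (Complex.I * φ) := by
      rw [← Complex.exp_add]; ring_nf
    have e2 : Complex.exp (-(Complex.I * (θ - φ)))
        = Complex.exp (-(Complex.I * θ)) * Complex.exp (Complex.I * φ) := by
      rw [← Complex.exp_add]; ring_nf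
    rw [QSu11.xi, e1, e2]
    simp only [mul_assoc]
  · have h := QSu11.isGeneralizedEigenfunction_xi hq0 hq1 hl θ
    exact ⟨h.rotate φ, h⟩
  · rw [QSu11.continuousSpectrum_rotate, QSu11.continuousSpectrum_hilbertI1]
  · rw [QSu11.spectrum_rotate, QSu11.spectrum_hilbertI1 hq0 hq1 hl hl4]
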